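/- \textbf{Conventions.} Let $\mathbb K\in\{\mathbb R,\mathbb C\}$. A map $f\colon U\to F$ from an open subset $U$ of a Hausdorff locally convex $\mathbb K$-vector space $E$ to a Hausdorff locally convex $\mathbb K$-vector space $F$ is $C^r_{\mathbb K}$ (with $r\in\mathbb N_0\cup\{\infty\}$) if for all integers $0\le j\leq r$ the iterated $\mathbb K$-directional derivatives $d^jf(x,y_1,\dots,y_j)=(D_{y_j}\cdots D_{y_1}f)(x)$ exist and are continuous in $(x,y_1,\dots,y_j)\in U\times E^j$; smooth means $C^\infty_{\mathbb K}$. A Lie group $G$ is a group with the structure of a Hausdorff $C^\infty_{\mathbb K}$-manifold modelled on a Hausdorff locally convex $\mathbb K$-vector space such that multiplication and inversion are smooth; $L(G):=T_{\mathbf 1}G$, and $g\cdot v:=(T_{\mathbf 1}\lambda_g)(v)\in T_gG$ for $g\in G$, $v\in L(G)$, where $\lambda_g(x)=gx$. For $k\in\mathbb N_0\cup\{\infty\}$, the space $C^k([0,1],E)$ (of curves that are $C^k$ in the real sense) carries the $C^k$-topology, i.e. the topology of uniform convergence of all derivatives of order $j\leq k$. A product integral of $\gamma\in C^k([0,1],L(G))$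 is a (necessarily unique) $C^{k+1}$-curve $\eta_\gamma\colon[0,1]\to G$ with $\eta_\gamma(0)=\mathbf 1$ and $\eta_\gamma'(t)=\eta_\gamma(t)\cdot\gamma(t)$ for all $t\in[0,1]$. For $k\in\mathbb N_0$, the Lie group $G$ is called strongly $C^k$-regular if each $\gamma\in C^k([0,1],L(G))$ has a product integral and the evolution map $\mathrm{evol}_G\colon C^k([0,1],L(G))\to G$, $\gamma\mapsto\eta_\gamma(1)$ is smooth. It is called regular (in Milnor's sense) if the same holds with $k=\infty$. For Hausdorff locally convex spaces $E_n$, the direct sum $\bigoplus_nE_n$ carries the box topology. For Lie groups $H_n$, the weak direct product $\prod^*_{n}H_n$ is the group of all $(x_n)_n\in\prod_nH_n$ with $x_n=\mathbf 1$ for all but finitely many $n$, with the box topology and the atlas of all charts $(y_n)_n\mapsto(\varphi_n(y_n))_n\in\bigoplus_nL(H_n)$, defined on the box given by the domains of the $\varphi_n$, where $(x_n)_n\in\prod^*_nH_n$ and $\varphi_n$ is a chart of $H_n$ around $x_n$ with $\varphi_n(x_n)=0$, which for each $n$ with $x_n=\mathbf 1$ is a fixed chart around $\mathbf 1$. \textbf{Theorem.}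 Let $k\in\mathbb N_0$ and let $(H_n)_{n\in\mathbb N}$ be a sequence of strongly $C^k$-regular Lie groups over $\mathbb K$. Then $\prod^*_nH_n$ is a Lie group modelled on $\bigoplus_nL(H_n)$, it is strongly $C^k$-regular, and it is regular in Milnor's sense. Moreover, $\gamma\mapsto(\gamma_n)_n$ (where $\gamma_n$ is the $n$-th component of $\gamma$) is an isomorphism of topological vector spaces \[ \Phi\colon C^k\Big([0,1],\bigoplus_nL(H_n)\Big)\to\bigoplus_nC^k([0,1],L(H_n)), \] one has $\mathrm{evol}_{H_n}(0)=\mathbf 1$ for each $n$, the map \[ \oplus_n\mathrm{evol}_{H_n}\colon\bigoplus_nC^k([0,1],L(H_n))\to\prod^*_nH_n,\qquad(\gamma_n)_n\mapsto(\mathrm{evol}_{H_n}(\gamma_n))_n \] is smooth, and $\mathrm{evol}_{\prod^*_nH_n}=(\oplus_n\mathrm{evol}_{H_n})\circ\Phi$. -/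

import Mathlib

open Topology Filter Set

noncomputable section

/-! ### Differential calculus in locally convex spaces (Keller's `C^r_c`-theory) -/

section Calculus

variable (𝕜 : Type*) [RCLike 𝕜]
variable {E F : Type*} [AddCommGroup E] [Module 𝕜 E] [AddCommGroup F] [Module 𝕜 F]

/-- `d = (D_y f)(x)`: the `𝕜`-directional derivative of `f` at `x` in the direction `y`. -/
def HasDirDeriv [TopologicalSpace F] (f : E → F) (x y : E) (d : F) : Prop :=
  Tendsto (fun s : 𝕜 => s⁻¹ • (f (x + s • y) - f x)) (𝓝[≠] 0) (𝓝 d)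

/-- `f` is a `C^r_𝕜`-map on the open set `U`: for all `j ≤ r` the iterated directional derivatives
`d^j f (x, y_1, …, y_j) = (D_{y_j} ⋯ D_{y_1} f)(x)` exist for `x ∈ U` and are continuous
on `U × E^j` (where `d^0 f = f`). -/
def IsCrOn [TopologicalSpace E] [TopologicalSpace F] (r : ℕ∞) (f : E → F) (U : Set E) : Prop :=
  ∃ d : (j : ℕ) → E → (Fin j → E) → F,
    (∀ x y, d 0 x y = f x) ∧
    (∀ j : ℕ, ((j + 1 : ℕ) : ℕ∞) ≤ r → ∀ x ∈ U, ∀ y : Fin (j + 1) → E,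
      HasDirDeriv 𝕜 (fun z => d j z (Fin.init y)) x (y (Fin.last j)) (d (j + 1) x y)) ∧
    (∀ j : ℕ, (j : ℕ∞) ≤ r →
      ContinuousOn (fun p : E × (Fin j → E) => d j p.1 p.2) (U ×ˢ univ))

end Calculus

/-! ### Curves on `[0,1]` and the spaces `C^k([0,1], E)` -/

section Curves

/-- `v` is the derivative at `t` of the curve `c : [0,1] → E` (one-sided at the end points). -/
def HasCurveDerivAt {E : Type*} [AddCommGroup E] [Module ℝ E] [TopologicalSpace E]
    (c : unitInterval → E) (v : E) (t : unitInterval) : Prop :=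
  Tendsto (fun s : unitInterval => ((s : ℝ) - (t : ℝ))⁻¹ • (c s - c t)) (𝓝[≠] t) (𝓝 v)

/-- The curve `c` is `C^r` on the relatively open subset `J` of `[0,1]`. -/
def IsCrCurveOn {E : Type*} [AddCommGroup E] [Module ℝ E] [TopologicalSpace E]
    (r : ℕ∞) (c : unitInterval → E) (J : Set unitInterval) : Prop :=
  ∃ D : ℕ → unitInterval → E,
    D 0 = c ∧
    (∀ j : ℕ, ((j + 1 : ℕ) : ℕ∞) ≤ r → ∀ t ∈ J, HasCurveDerivAt (D j) (D (j + 1) t) t) ∧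
    (∀ j : ℕ, (j : ℕ∞) ≤ r → ContinuousOn (D j) J)

variable (𝕜 : Type*) [RCLike 𝕜] (k : ℕ∞)
variable (E : Type*) [AddCommGroup E] [Module ℝ E] [Module 𝕜 E] [IsScalarTower ℝ 𝕜 E]
  [TopologicalSpace E] [IsTopologicalAddGroup E] [ContinuousSMul 𝕜 E]

/-- The locally convex space `C^k([0,1], E)`, for `k ∈ ℕ₀ ∪ {∞}`. A `C^k`-curve `γ` is encoded by
the family `(γ^(j))_{j ≤ k}` of its derivatives (which is determined by `γ = γ^(0)`), and
the `C^k`-topology is the topology of uniform convergence of all derivatives of order `j ≤ k`,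
that is, the topology induced by the product of the spaces `C([0,1], E)`. -/
def CkCurve : Submodule 𝕜 ({j : ℕ // (j : ℕ∞) ≤ k} → C(unitInterval, E)) where
  carrier := {D | ∀ (j : ℕ) (hj : ((j + 1 : ℕ) : ℕ∞) ≤ k) (t : unitInterval),
    HasCurveDerivAt (D ⟨j, le_trans (by exact_mod_cast j.le_succ) hj⟩) (D ⟨j + 1, hj⟩ t) t}
  add_mem' := by
    intro a b ha hb j hj t
    refine ((ha j hj t).add (hb j hj t)).congr fun s => ?_
    simp only [Pi.add_apply, ContinuousMap.add_apply, ← smul_add]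
    congr 1
    abel
  zero_mem' := by
    intro j hj t
    simpa [HasCurveDerivAt] using (tendsto_const_nhds : Tendsto (fun _ => (0 : E)) (𝓝[≠] t) (𝓝 0))
  smul_mem' := by
    intro c a ha j hj t
    refine ((ha j hj t).const_smul c).congr fun s => ?_
    simp only [Pi.smul_apply, ContinuousMap.smul_apply, ← smul_sub]
    exact smul_comm _ _ _

variable {𝕜 k E}

/-- The underlying curve `[0,1] → E` of an element of `C^k([0,1], E)`. -/
def CkCurve.curve (γ : CkCurve 𝕜 k E) : unitInterval → E :=
  γ.1 ⟨0, by simp⟩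

end Curves

/-! ### Lie groups modelled on locally convex spaces -/

section LieGroups

/-- `G`, with the given topology and atlas, is a `C^∞_𝕜`-Lie group modelled on the Hausdorff
locally convex space `E`. -/
structure IsLCLieGroup (𝕜 : Type*) [RCLike 𝕜] (E : Type*) [AddCommGroup E] [Module ℝ E]
    [Module 𝕜 E] [TopologicalSpace E]
    (G : Type*) [Group G] [TopologicalSpace G] [ChartedSpace E G] : Prop where
  model_isTopologicalAddGroup : IsTopologicalAddGroup E
  model_continuousSMul : ContinuousSMul 𝕜 E
  model_locallyConvex : LocallyConvexSpace ℝ E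
  model_t2 : T2Space E
  t2 : T2Space G
  smooth_transition : ∀ e ∈ atlas E G, ∀ e' ∈ atlas E G,
    IsCrOn 𝕜 ⊤ (fun x => e' (e.symm x)) {x | x ∈ e.target ∧ e.symm x ∈ e'.source}
  isTopologicalGroup : IsTopologicalGroup G
  smooth_mul : ∀ e ∈ atlas E G, ∀ e' ∈ atlas E G, ∀ e'' ∈ atlas E G,
    IsCrOn 𝕜 ⊤ (fun p : E × E => e'' (e.symm p.1 * e'.symm p.2))
      {p | p.1 ∈ e.target ∧ p.2 ∈ e'.target ∧ e.symm p.1 * e'.symm p.2 ∈ e''.source}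
  smooth_inv : ∀ e ∈ atlas E G, ∀ e' ∈ atlas E G,
    IsCrOn 𝕜 ⊤ (fun x => e' (e.symm x)⁻¹) {x | x ∈ e.target ∧ (e.symm x)⁻¹ ∈ e'.source}

/-- `f : X → M`, from a locally convex space `X` to a manifold modelled on `E`, is `C^∞_𝕜`. -/
def IsSmoothInto (𝕜 : Type*) [RCLike 𝕜] {X : Type*} [AddCommGroup X] [Module 𝕜 X]
    [TopologicalSpace X] (E : Type*) [AddCommGroup E] [Module 𝕜 E] [TopologicalSpace E]
    {M : Type*} [TopologicalSpace M] [ChartedSpace E M] (f : X → M) : Prop :=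
  Continuous f ∧ ∀ e ∈ atlas E M, IsCrOn 𝕜 ⊤ (fun x => e (f x)) (f ⁻¹' e.source)

/-- `η : [0,1] → M` is a `C^r`-curve in a manifold modelled on `E`. -/
def IsCrManifoldCurve (E : Type*) [AddCommGroup E] [Module ℝ E] [TopologicalSpace E]
    {M : Type*} [TopologicalSpace M] [ChartedSpace E M] (r : ℕ∞) (η : unitInterval → M) : Prop :=
  Continuous η ∧ ∀ e ∈ atlas E M, IsCrCurveOn r (fun t => e (η t)) (η ⁻¹' e.source)

/-- `η'(t) = w` in `T_{η(t)} M`. As for `TangentSpace`, each tangent space `T_x M` is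
identified with `E` by means of the preferred chart `chartAt E x`. -/
def HasVelocityAt {E : Type*} [AddCommGroup E] [Module ℝ E] [TopologicalSpace E]
    {M : Type*} [TopologicalSpace M] [ChartedSpace E M] (η : unitInterval → M) (w : E)
    (t : unitInterval) : Prop :=
  HasCurveDerivAt (fun s => chartAt E (η t) (η s)) w t

/-- `T_x f (v) = w` in `T_{f(x)} N`, for `v ∈ T_x M`. -/
def HasTangentMapAt (𝕜 : Type*) [RCLike 𝕜]
    {E F : Type*} [AddCommGroup E] [Module 𝕜 E] [TopologicalSpace E]
    [AddCommGroup F] [Module 𝕜 F] [TopologicalSpace F]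
    {M N : Type*} [TopologicalSpace M] [ChartedSpace E M] [TopologicalSpace N] [ChartedSpace F N]
    (f : M → N) (x : M) (v : E) (w : F) : Prop :=
  HasDirDeriv 𝕜 (fun z => chartAt F (f x) (f ((chartAt E x).symm z))) (chartAt E x x) v w

end LieGroups

/-! ### Evolution and regularity -/

section Regularity

/-- `η` is a product integral of the curve `γ` in `Lie(G) = T_1 G`: a `C^r`-curve with
`η(0) = 1` and `η'(t) = η(t) · γ(t)` for all `t`, where `g · v = T_1(λ_g)(v)` for the left
translation `λ_g : x ↦ g x`. -/
def IsProductIntegral (𝕜 : Type*) [RCLike 𝕜] {E : Type*} [AddCommGroup E] [Module ℝ E]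
    [Module 𝕜 E] [TopologicalSpace E] {G : Type*} [Group G] [TopologicalSpace G]
    [ChartedSpace E G] (r : ℕ∞) (γ : unitInterval → E) (η : unitInterval → G) : Prop :=
  IsCrManifoldCurve E r η ∧ η 0 = 1 ∧
    ∀ t : unitInterval, ∃ w : E,
      HasTangentMapAt 𝕜 (fun x : G => η t * x) 1 (γ t) w ∧
      HasVelocityAt η w t

variable (𝕜 : Type*) [RCLike 𝕜] (k : ℕ∞)
variable (E : Type*) [AddCommGroup E] [Module ℝ E] [Module 𝕜 E] [IsScalarTower ℝ 𝕜 E]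
  [TopologicalSpace E] [IsTopologicalAddGroup E] [ContinuousSMul 𝕜 E]
variable (G : Type*) [Group G] [TopologicalSpace G] [ChartedSpace E G]

open Classical in
/-- The evolution map `evol_G : C^k([0,1], Lie(G)) → G`, `γ ↦ η_γ(1)`, where `η_γ` is the
(necessarily unique) product integral of `γ`, of class `C^{k+1}`; the value is `1` if there is
no product integral. -/
def evol (γ : CkCurve 𝕜 k E) : G :=
  if h : ∃ η : unitInterval → G, IsProductIntegral 𝕜 (k + 1) (CkCurve.curve γ) η then h.choose 1 else 1

/-- Each `γ ∈ C^k([0,1], Lie(G))` has a product integral and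
`evol_G : C^k([0,1], Lie(G)) → G` is smooth. -/
def HasSmoothEvolution : Prop :=
  (∀ γ : CkCurve 𝕜 k E, ∃ η : unitInterval → G, IsProductIntegral 𝕜 (k + 1) (CkCurve.curve γ) η) ∧
    IsSmoothInto 𝕜 E (evol 𝕜 k E G)

/-- The Lie group `G` is strongly `C^k`-regular, for finite `k`. -/
def IsStronglyRegular (k : ℕ) : Prop := HasSmoothEvolution 𝕜 (k : ℕ∞) E G

/-- The Lie group `G` is regular in Milnor's sense: smooth curves in `Lie(G)` have smooth product
integrals, and `evol_G : C^∞([0,1], Lie(G)) → G` is smooth. -/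
def IsMilnorRegular : Prop := HasSmoothEvolution 𝕜 (⊤ : ℕ∞) E G

end Regularity

/-! ### Weak direct products and locally convex direct sums -/

/-- The families `(x_n)_n ∈ ∏_n X_n` such that `x_n` is the base point `b_n` for all but finitely
many `n`. -/
@[ext]
structure FinProd (X : ℕ → Type*) (b : ∀ n, X n) where
  val : ∀ n, X n
  finite : ∀ᶠ n in cofinite, val n = b n

namespace FinProd

section Basic

variable {X Y : ℕ → Type*} {b : ∀ n, X n} {c : ∀ n, Y n}

instance : CoeFun (FinProd X b) (fun _ => ∀ n, X n) := ⟨FinProd.val⟩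

/-- The map `(x_n)_n ↦ (f_n(x_n))_n`, defined if `f_n(b_n) = c_n` for almost all `n`. -/
def map (f : ∀ n, X n → Y n) (hf : ∀ᶠ n in cofinite, f n (b n) = c n) (x : FinProd X b) :
    FinProd Y c :=
  ⟨fun n => f n (x n), by
    filter_upwards [x.finite, hf] with n h1 h2
    rw [h1, h2]⟩

variable [∀ n, TopologicalSpace (X n)] [∀ n, TopologicalSpace (Y n)]

/-- The box topology, generated by the boxes `∏_n U_n` with each `U_n` open. -/
instance : TopologicalSpace (FinProd X b) :=
  TopologicalSpace.generateFrom
    {S | ∃ U : ∀ n, Set (X n), (∀ n, IsOpen (U n)) ∧ S = {x | ∀ n, x n ∈ U n}}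

theorem isOpen_box {U : ∀ n, Set (X n)} (hU : ∀ n, IsOpen (U n)) :
    IsOpen {x : FinProd X b | ∀ n, x n ∈ U n} :=
  TopologicalSpace.isOpen_generateFrom_of_mem ⟨U, hU, rfl⟩

theorem isTopologicalBasis_box : TopologicalSpace.IsTopologicalBasis
    {S : Set (FinProd X b) |
      ∃ U : ∀ n, Set (X n), (∀ n, IsOpen (U n)) ∧ S = {x | ∀ n, x n ∈ U n}} where
  exists_subset_inter := by
    rintro _ ⟨U, hU, rfl⟩ _ ⟨V, hV, rfl⟩ x ⟨hx, hx'⟩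
    exact ⟨_, ⟨fun n => U n ∩ V n, fun n => (hU n).inter (hV n), rfl⟩,
      fun n => ⟨hx n, hx' n⟩, fun y hy => ⟨fun n => (hy n).1, fun n => (hy n).2⟩⟩
  sUnion_eq := eq_univ_of_forall fun x =>
    ⟨univ, ⟨fun _ => univ, fun _ => isOpen_univ, by simp⟩, mem_univ x⟩
  eq_generateFrom := rfl

theorem hasBasis_nhds (x : FinProd X b) :
    (𝓝 x).HasBasis (fun U : ∀ n, Set (X n) => ∀ n, U n ∈ 𝓝 (x n))
      (fun U => {y | ∀ n, y n ∈ U n}) := by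
  refine ⟨fun s => ?_⟩
  rw [isTopologicalBasis_box.mem_nhds_iff]
  constructor
  · rintro ⟨_, ⟨U, hU, rfl⟩, hx, hs⟩
    exact ⟨U, fun n => (hU n).mem_nhds (hx n), hs⟩
  · rintro ⟨U, hU, hs⟩
    exact ⟨_, ⟨fun n => interior (U n), fun n => isOpen_interior, rfl⟩,
      fun n => mem_interior_iff_mem_nhds.2 (hU n),
      fun y hy => hs fun n => interior_subset (hy n)⟩

theorem box_mem_nhds {x : FinProd X b} {U : ∀ n, Set (X n)} (hU : ∀ n, U n ∈ 𝓝 (x n)) :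
    {y : FinProd X b | ∀ n, y n ∈ U n} ∈ 𝓝 x :=
  (hasBasis_nhds x).mem_of_mem hU

theorem continuousAt_map {f : ∀ n, X n → Y n} (hf : ∀ᶠ n in cofinite, f n (b n) = c n)
    {x : FinProd X b} (h : ∀ n, ContinuousAt (f n) (x n)) : ContinuousAt (map (c := c) f hf) x := by
  refine (hasBasis_nhds _).tendsto_right_iff.2 fun U hU => ?_
  exact box_mem_nhds (x := x) fun n => h n (hU n)

/-- The chart `(x_n)_n ↦ (φ_n(x_n))_n` defined by a sequence of charts `φ_n` such that
`φ_n` is defined at `b_n` and maps `b_n` to `c_n` for almost all `n`; its domain is the box given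
by the domains of the `φ_n`. -/
def boxChart (φ : ∀ n, OpenPartialHomeomorph (X n) (Y n))
    (hφ : ∀ᶠ n in cofinite, b n ∈ (φ n).source ∧ φ n (b n) = c n) :
    OpenPartialHomeomorph (FinProd X b) (FinProd Y c) where
  toFun := map (fun n => φ n) (hφ.mono fun _ h => h.2)
  invFun := map (fun n => (φ n).symm)
    (hφ.mono fun n h => by rw [← h.2, (φ n).left_inv h.1])
  source := {x | ∀ n, x n ∈ (φ n).source}
  target := {y | ∀ n, y n ∈ (φ n).target}
  map_source' x hx n := (φ n).map_source (hx n)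
  map_target' y hy n := (φ n).map_target (hy n)
  left_inv' x hx := FinProd.ext (funext fun n => (φ n).left_inv (hx n))
  right_inv' y hy := FinProd.ext (funext fun n => (φ n).right_inv (hy n))
  open_source := isOpen_box fun n => (φ n).open_source
  open_target := isOpen_box fun n => (φ n).open_target
  continuousOn_toFun x hx :=
    (continuousAt_map _ fun n => (φ n).continuousAt (hx n)).continuousWithinAt
  continuousOn_invFun y hy :=
    (continuousAt_map _ fun n => (φ n).continuousAt_symm (hy n)).continuousWithinAt

end Basic

end FinProd

/-- The locally convex direct sum `⨁_n E_n`, with componentwise vector space structure and the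
box topology. -/
abbrev LCDirectSum (E : ℕ → Type*) [∀ n, AddCommGroup (E n)] : Type _ :=
  FinProd E (fun _ => 0)

/-- The weak direct product `∏*_n H_n`, with componentwise group structure and the box topology. -/
abbrev WeakProd (H : ℕ → Type*) [∀ n, Group (H n)] : Type _ :=
  FinProd H (fun _ => 1)

section WeakProdGroup

variable {H : ℕ → Type*} [∀ n, Group (H n)]

instance : Group (WeakProd H) where
  mul x y := ⟨fun n => x n * y n, by
    filter_upwards [x.finite, y.finite] with n h1 h2
    simp [h1, h2]⟩
  one := ⟨fun _ => 1, Eventually.of_forall fun _ => rfl⟩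
  inv x := ⟨fun n => (x n)⁻¹, by
    filter_upwards [x.finite] with n h
    simp [h]⟩
  mul_assoc x y z := FinProd.ext (funext fun n => mul_assoc (x n) (y n) (z n))
  one_mul x := FinProd.ext (funext fun n => one_mul (x n))
  mul_one x := FinProd.ext (funext fun n => mul_one (x n))
  inv_mul_cancel x := FinProd.ext (funext fun n => inv_mul_cancel (x n))

end WeakProdGroup

namespace LCDirectSum

variable {E : ℕ → Type*} [∀ n, AddCommGroup (E n)]

instance {R : Type*} [Semiring R] [∀ n, Module R (E n)] : SMul R (LCDirectSum E) where
  smul r x := ⟨fun n => r • x n, by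
    filter_upwards [x.finite] with n h
    simp [h]⟩

instance : Add (LCDirectSum E) where
  add x y := ⟨fun n => x n + y n, by
    filter_upwards [x.finite, y.finite] with n h1 h2
    simp [h1, h2]⟩

instance : Neg (LCDirectSum E) where
  neg x := ⟨fun n => -x n, by
    filter_upwards [x.finite] with n h
    simp [h]⟩

instance : Zero (LCDirectSum E) := ⟨⟨fun _ => 0, Eventually.of_forall fun _ => rfl⟩⟩

instance : AddCommGroup (LCDirectSum E) where
  add_assoc x y z := FinProd.ext (funext fun n => add_assoc (x n) (y n) (z n))
  zero_add x := FinProd.ext (funext fun n => zero_add (x n))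
  add_zero x := FinProd.ext (funext fun n => add_zero (x n))
  neg_add_cancel x := FinProd.ext (funext fun n => neg_add_cancel (x n))
  add_comm x y := FinProd.ext (funext fun n => add_comm (x n) (y n))
  nsmul m x := m • x
  nsmul_zero x := FinProd.ext (funext fun n => zero_nsmul (x n))
  nsmul_succ m x := FinProd.ext (funext fun n => succ_nsmul (x n) m)
  zsmul m x := m • x
  zsmul_zero' x := FinProd.ext (funext fun n => zero_zsmul (x n))
  zsmul_succ' m x := FinProd.ext (funext fun n => SubNegMonoid.zsmul_succ' m (x n))
  zsmul_neg' m x := FinProd.ext (funext fun n => SubNegMonoid.zsmul_neg' m (x n))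

instance {R : Type*} [Semiring R] [∀ n, Module R (E n)] : Module R (LCDirectSum E) where
  one_smul x := FinProd.ext (funext fun n => one_smul R (x n))
  mul_smul r s x := FinProd.ext (funext fun n => mul_smul r s (x n))
  smul_zero r := FinProd.ext (funext fun _ => smul_zero r)
  smul_add r x y := FinProd.ext (funext fun n => smul_add r (x n) (y n))
  add_smul r s x := FinProd.ext (funext fun n => add_smul r s (x n))
  zero_smul x := FinProd.ext (funext fun n => zero_smul R (x n))

instance {𝕜 : Type*} [RCLike 𝕜] [∀ n, Module ℝ (E n)] [∀ n, Module 𝕜 (E n)]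
    [∀ n, IsScalarTower ℝ 𝕜 (E n)] : IsScalarTower ℝ 𝕜 (LCDirectSum E) where
  smul_assoc r s x := FinProd.ext (funext fun n => smul_assoc r s (x n))

variable [∀ n, TopologicalSpace (E n)]

instance [∀ n, IsTopologicalAddGroup (E n)] : IsTopologicalAddGroup (LCDirectSum E) where
  continuous_add := by
    refine continuous_iff_continuousAt.2 fun ⟨x, y⟩ => ?_
    refine (FinProd.hasBasis_nhds _).tendsto_right_iff.2 fun U hU => ?_
    have h : ∀ n, ∃ V ∈ 𝓝 (x n), ∃ W ∈ 𝓝 (y n), ∀ v ∈ V, ∀ w ∈ W, v + w ∈ U n := by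
      intro n
      have := (continuous_add.tendsto (x n, y n)) (hU n)
      rw [mem_map, nhds_prod_eq, mem_prod_iff] at this
      obtain ⟨V, hV, W, hW, h⟩ := this
      exact ⟨V, hV, W, hW, fun v hv w hw => h (mk_mem_prod hv hw)⟩
    choose V hV W hW h using h
    filter_upwards [prod_mem_nhds (FinProd.box_mem_nhds hV) (FinProd.box_mem_nhds hW)]
      with p hp n
    exact h n _ (hp.1 n) _ (hp.2 n)
  continuous_neg := continuous_iff_continuousAt.2 fun x =>
    FinProd.continuousAt_map (f := fun n => (fun v : E n => -v))
      (Eventually.of_forall fun _ => neg_zero) fun _ => continuous_neg.continuousAt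

instance {𝕜 : Type*} [RCLike 𝕜] [∀ n, Module 𝕜 (E n)] [∀ n, IsTopologicalAddGroup (E n)]
    [∀ n, ContinuousSMul 𝕜 (E n)] : ContinuousSMul 𝕜 (LCDirectSum E) := by
  refine ContinuousSMul.of_nhds_zero ?_ ?_ ?_
  · refine (FinProd.hasBasis_nhds _).tendsto_right_iff.2 fun U hU => ?_
    have h : ∀ n, ∃ V ∈ 𝓝 (0 : E n), ∀ a : 𝕜, ‖a‖ ≤ 1 → ∀ v ∈ V, a • v ∈ U n := by
      intro n
      refine ⟨balancedCore 𝕜 (U n), balancedCore_mem_nhds_zero (hU n), fun a ha v hv => ?_⟩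
      exact balancedCore_subset (U n) ((balancedCore_balanced (U n)).smul_mem ha hv)
    choose V hV h using h
    filter_upwards [prod_mem_prod (Metric.closedBall_mem_nhds (0 : 𝕜) one_pos)
      (FinProd.box_mem_nhds (x := (0 : LCDirectSum E)) hV)] with p hp n
    exact h n _ (by simpa using hp.1) _ (hp.2 n)
  · intro m
    refine (FinProd.hasBasis_nhds _).tendsto_right_iff.2 fun U hU => ?_
    have hm : {n | m n ≠ 0}.Finite := m.finite
    have h1 : ∀ n ∈ {n | m n ≠ 0}, ∀ᶠ a : 𝕜 in 𝓝 0, a • m n ∈ U n := by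
      intro n _
      have : Tendsto (fun a : 𝕜 => a • m n) (𝓝 0) (𝓝 0) := by
        simpa using (show Continuous fun a : 𝕜 => a • m n by fun_prop).tendsto 0
      exact this (hU n)
    filter_upwards [(eventually_all_finite hm).2 h1] with a ha n
    by_cases hn : m n = 0
    · have : (a • m) n = 0 := by
        change a • m n = 0
        rw [hn, smul_zero]
      rw [this]
      exact mem_of_mem_nhds (hU n)
    · exact ha n hn
  · intro a
    have h := FinProd.continuousAt_map (c := fun n => (0 : E n))
      (f := fun n => (fun v : E n => a • v))
      (Eventually.of_forall fun _ => smul_zero a) (x := (0 : LCDirectSum E))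
      fun _ => (continuous_const_smul a).continuousAt
    have h0 : a • (0 : LCDirectSum E) = 0 := smul_zero a
    have h' : Tendsto (fun m : LCDirectSum E => a • m) (𝓝 0) (𝓝 (a • 0)) := h
    rwa [h0] at h'

end LCDirectSum

section WeakProdCharts

variable {E : ℕ → Type*} [∀ n, AddCommGroup (E n)] [∀ n, TopologicalSpace (E n)]
  [∀ n, IsTopologicalAddGroup (E n)]
variable {H : ℕ → Type*} [∀ n, Group (H n)] [∀ n, TopologicalSpace (H n)]
  [∀ n, ChartedSpace (E n) (H n)]

/-- The preferred chart of a manifold around `x`, translated such that it maps `x` to `0`. -/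
def centeredChartAt (E : Type*) [AddCommGroup E] [TopologicalSpace E] [IsTopologicalAddGroup E]
    {M : Type*} [TopologicalSpace M] [ChartedSpace E M] (x : M) : OpenPartialHomeomorph M E :=
  (chartAt E x).transHomeomorph (Homeomorph.subRight (chartAt E x x))

/-- The manifold structure on the weak direct product `∏*_n H_n`, modelled on `⨁_n E_n`: around
`x = (x_n)_n`, a chart is the product `(y_n)_n ↦ (φ_n(y_n))_n` of charts `φ_n` of the `H_n`
around `x_n` with `φ_n(x_n) = 0`. -/
instance : ChartedSpace (LCDirectSum E) (WeakProd H) where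
  atlas := range fun x : WeakProd H => FinProd.boxChart (c := fun n => (0 : E n))
    (fun n => centeredChartAt (E n) (x n)) (by
      filter_upwards [x.finite] with n h
      rw [h]
      simp [centeredChartAt])
  chartAt x := FinProd.boxChart (c := fun n => (0 : E n))
    (fun n => centeredChartAt (E n) (x n)) (by
      filter_upwards [x.finite] with n h
      rw [h]
      simp [centeredChartAt])
  mem_chart_source x n := by simp [centeredChartAt]
  chart_mem_atlas x := mem_range_self x

end WeakProdCharts

end

/-!
Smoothness into a box-topology direct sum is a componentwise matter. If maps `f_n` between locally
convex spaces are smooth, then so is the map they induce on direct sums: its `j`-th differential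
acts componentwise, and takes values in the direct sum because `d^j f_n` vanishes when its last
direction is `0` (`IsCrOn.directSum`). Up to translations and the regrouping of pairs, the
transition maps, the multiplication and the inversion of the weak direct product are of this kind
(`WeakProd.isLCLieGroup`), and so is `⊕_n evol_{H_n}` in charts (`IsSmoothInto.weakProd`).

Since a compact subset of the direct sum has only finitely many nonzero components, a `C^k`-curve
in `⨁_n E_n` has almost all components zero; this yields the bijection `Φ`. For finite `k`, a basis
of zero neighbourhoods of `C^k([0,1], E)` is given by the conditions `γ^(j)(t) ∈ W` for all `t` and
all `j ≤ k`, with a single zero neighbourhood `W` of `E`; taking boxes for `W` shows that `Φ` is a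
homeomorphism (`CkCurve.directSumEquiv`). Product integrals in the weak direct product are formed
componentwise, almost all components being constant (`WeakProd.isProductIntegral`).

To identify the evolution map, product integrals have to be unique. Call two curves in a manifold
tangent at `t` if their difference in charts is `o(s - t)`. By a strict form of the chain rule
(`tendsto_slope_of_dirDeriv`), a consequence of the mean value theorem and the Hahn-Banach theorem,
tangency is preserved by smooth maps, in particular by the group operations. If `η` and `ξ` are
product integrals of `γ`, then near `t` both `η` and `ξ` are tangent to left translates of one
curve `β` through `1`, whence `η ξ⁻¹` is tangent to a constant and thus is constant
(`IsProductIntegral.unique`).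

Finally, regularity in Milnor's sense follows from strong `C^k`-regularity. The product integral of
a smooth curve solves an ordinary differential equation with smooth right-hand side in charts. As
composites of smooth maps and `C^m`-curves are `C^m`
(`IsDifferentialFamily.isCrCurveOn_comp`, based on the multilinearity of the differentials), the
solution is smooth by induction on `m` (`IsProductIntegral.isCrManifoldCurve_top`). Hence the
evolution map on smooth curves is the restriction of the one on `C^k`-curves.

Real differentiability suffices for uniqueness and for the smoothness of product integrals, so these
are obtained over `ℝ`, after restriction of scalars.
-/

noncomputable section

/-! ### Restriction of scalars -/

section RestrictScalars

variable {𝕜 : Type*} [RCLike 𝕜]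
  {E : Type*} [AddCommGroup E] [Module ℝ E] [Module 𝕜 E] [IsScalarTower ℝ 𝕜 E]
  {F : Type*} [AddCommGroup F] [Module ℝ F] [Module 𝕜 F] [IsScalarTower ℝ 𝕜 F]
  [TopologicalSpace F]

theorem tendsto_ofReal_nhdsNE_zero : Tendsto (fun s : ℝ => (s : 𝕜)) (𝓝[≠] 0) (𝓝[≠] 0) := by
  refine tendsto_nhdsWithin_iff.2 ⟨?_, ?_⟩
  · have : Tendsto (fun s : ℝ => (s : 𝕜)) (𝓝 0) (𝓝 ((0 : ℝ) : 𝕜)) :=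
      (RCLike.continuous_ofReal (K := 𝕜)).tendsto 0
    rw [RCLike.ofReal_zero] at this
    exact this.mono_left nhdsWithin_le_nhds
  · filter_upwards [self_mem_nhdsWithin] with s hs
    simpa using hs

theorem HasDirDeriv.restrictScalars {f : E → F} {x y : E} {d : F} (h : HasDirDeriv 𝕜 f x y d) :
    HasDirDeriv ℝ f x y d := by
  refine (h.comp tendsto_ofReal_nhdsNE_zero).congr fun s => ?_
  rw [Function.comp_apply, RCLike.real_smul_eq_coe_smul (K := 𝕜) s y,
    RCLike.real_smul_eq_coe_smul (K := 𝕜) s⁻¹, RCLike.ofReal_inv]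

theorem IsCrOn.restrictScalars [TopologicalSpace E] {r : ℕ∞} {f : E → F} {U : Set E}
    (h : IsCrOn 𝕜 r f U) : IsCrOn ℝ r f U := by
  obtain ⟨d, h0, h1, h2⟩ := h
  exact ⟨d, h0, fun j hj x hx y => (h1 j hj x hx y).restrictScalars, h2⟩

theorem IsLCLieGroup.restrictScalars [TopologicalSpace E] {G : Type*} [Group G]
    [TopologicalSpace G] [ChartedSpace E G] (h : IsLCLieGroup 𝕜 E G) : IsLCLieGroup ℝ E G where
  model_isTopologicalAddGroup := h.model_isTopologicalAddGroup
  model_continuousSMul := by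
    have := h.model_continuousSMul
    exact IsScalarTower.continuousSMul 𝕜
  model_locallyConvex := h.model_locallyConvex
  model_t2 := h.model_t2
  t2 := h.t2
  smooth_transition e he e' he' := (h.smooth_transition e he e' he').restrictScalars
  isTopologicalGroup := h.isTopologicalGroup
  smooth_mul e he e' he' e'' he'' := (h.smooth_mul e he e' he' e'' he'').restrictScalars
  smooth_inv e he e' he' := (h.smooth_inv e he e' he').restrictScalars

theorem IsProductIntegral.restrictScalars [TopologicalSpace E] {G : Type*} [Group G]
    [TopologicalSpace G] [ChartedSpace E G] {r : ℕ∞} {γ : unitInterval → E}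
    {η : unitInterval → G} (h : IsProductIntegral 𝕜 r γ η) : IsProductIntegral ℝ r γ η :=
  ⟨h.1, h.2.1, fun t => let ⟨w, h1, h2⟩ := h.2.2 t; ⟨w, h1.restrictScalars, h2⟩⟩

end RestrictScalars

/-! ### The strict chain rule -/

section RealCalculus

variable {E : Type*} [AddCommGroup E] [Module ℝ E]
  {F : Type*} [AddCommGroup F] [Module ℝ F] [TopologicalSpace F]

theorem HasDirDeriv.hasDerivAt_comp_line {f : E → F} {z q : E} {d : F} {r : ℝ}
    (φ : F →L[ℝ] ℝ) (h : HasDirDeriv ℝ f (z + r • q) q d) :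
    HasDerivAt (fun r : ℝ => φ (f (z + r • q))) (φ d) r := by
  rw [hasDerivAt_iff_tendsto_slope_zero]
  refine ((φ.continuous.tendsto d).comp h).congr fun s => ?_
  simp [add_smul, add_assoc]

variable [IsTopologicalAddGroup F] [ContinuousSMul ℝ F]

/-- Mean value theorem: the average slope of `f` along a segment in direction `q` lies in every
open convex set containing all the directional derivatives along that segment. -/
theorem slope_mem_of_dirDeriv_mem {f : E → F} {f' : E → E → F} {z q : E} {h : ℝ} (hne : h ≠ 0)
    {W : Set F} (hWc : Convex ℝ W) (hWo : IsOpen W)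
    (hd : ∀ r ∈ Icc (0 : ℝ) 1, HasDirDeriv ℝ f (z + (r * h) • q) q (f' (z + (r * h) • q) q))
    (hW : ∀ r ∈ Icc (0 : ℝ) 1, f' (z + (r * h) • q) q ∈ W) :
    h⁻¹ • (f (z + h • q) - f z) ∈ W := by
  by_contra hn
  obtain ⟨φ, hφ⟩ := geometric_hahn_banach_open_point hWc hWo hn
  have hder : ∀ r ∈ Icc (0 : ℝ) 1,
      HasDerivAt (fun r : ℝ => φ (f (z + (r * h) • q))) (φ (f' (z + (r * h) • q) q) * h) r := by
    intro r hr
    exact ((hd r hr).hasDerivAt_comp_line φ).comp r (hasDerivAt_mul_const h)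
  obtain ⟨c, hc, hcs⟩ := exists_hasDerivAt_eq_slope (fun r : ℝ => φ (f (z + (r * h) • q)))
    (fun r => φ (f' (z + (r * h) • q) q) * h) zero_lt_one
    (fun r hr => (hder r hr).continuousAt.continuousWithinAt)
    (fun r hr => hder r (Ioo_subset_Icc_self hr))
  have h1 := hφ _ (hW c (Ioo_subset_Icc_self hc))
  simp only [one_mul, zero_mul, zero_smul, add_zero, sub_zero, div_one] at hcs
  rw [map_smul, map_sub, ← hcs, smul_eq_mul, mul_comm (φ _) h,
    inv_mul_cancel_left₀ hne] at h1
  exact lt_irrefl _ h1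

variable [LocallyConvexSpace ℝ F]
  [TopologicalSpace E] [LocallyConvexSpace ℝ E]

/-- The strict chain rule for a `C^1`-map `f` with differential `f'`: neither `x` nor `y` need be
differentiable, only their difference matters. -/
theorem tendsto_slope_of_dirDeriv {ι : Type*} {l : Filter ι} {f : E → F} {f' : E → E → F}
    {U : Set E} (hU : IsOpen U) (hf : ∀ x ∈ U, ∀ y, HasDirDeriv ℝ f x y (f' x y))
    (hf' : ContinuousOn (fun p : E × E => f' p.1 p.2) (U ×ˢ univ))
    {x y : ι → E} {h : ι → ℝ} {x₀ v : E} (hx₀ : x₀ ∈ U) (hx : Tendsto x l (𝓝 x₀))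
    (hy : Tendsto y l (𝓝 x₀)) (hh : ∀ᶠ i in l, h i ≠ 0)
    (hq : Tendsto (fun i => (h i)⁻¹ • (x i - y i)) l (𝓝 v)) :
    Tendsto (fun i => (h i)⁻¹ • (f (x i) - f (y i))) l (𝓝 (f' x₀ v)) := by
  intro W hW
  rw [mem_map]
  -- shrink the neighbourhood `W` of the limit to an open convex one
  obtain ⟨W', ⟨hW'0, hW'o, hW'c⟩, hW'⟩ :=
    (LocallyConvexSpace.convex_open_basis_zero ℝ F).mem_iff.1
      (show (fun w => f' x₀ v + w) ⁻¹' W ∈ 𝓝 (0 : F) from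
        (show Continuous fun w => f' x₀ v + w by fun_prop).continuousAt (by simpa using hW))
  set W₁ : Set F := (fun w => -f' x₀ v + w) ⁻¹' W' with hW₁
  have hW₁o : IsOpen W₁ := hW'o.preimage (by fun_prop)
  have hW₁c : Convex ℝ W₁ := hW'c.translate_preimage_right _
  have hW₁W : W₁ ⊆ W := fun w hw => by
    have := hW' hw
    simpa using this
  have hcont : ContinuousAt (fun p : E × E => f' p.1 p.2) (x₀, v) :=
    hf'.continuousAt ((hU.prod isOpen_univ).mem_nhds ⟨hx₀, mem_univ _⟩)
  have hmem : (fun p : E × E => f' p.1 p.2) ⁻¹' W₁ ∈ 𝓝 (x₀, v) :=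
    hcont (hW₁o.mem_nhds (by simpa [hW₁] using hW'0))
  rw [nhds_prod_eq, mem_prod_iff] at hmem
  obtain ⟨A, hA, B, hB, hAB⟩ := hmem
  obtain ⟨A', ⟨hA', hA'c⟩, hA'A⟩ := (LocallyConvexSpace.convex_basis (𝕜 := ℝ) x₀).mem_iff.1
    (inter_mem hA (hU.mem_nhds hx₀))
  filter_upwards [hx hA', hy hA', hh, hq hB] with i hxi hyi hi hqi
  set q := (h i)⁻¹ • (x i - y i) with hq_def
  have hseg : ∀ r ∈ Icc (0 : ℝ) 1, y i + (r * h i) • q ∈ A' := by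
    intro r hr
    have : y i + (r * h i) • q = y i + r • (x i - y i) := by
      rw [hq_def, smul_smul, mul_assoc, mul_inv_cancel₀ hi, mul_one]
    rw [this]
    exact hA'c.add_smul_sub_mem hyi hxi hr
  have hxq : y i + h i • q = x i := by
    rw [hq_def, smul_smul, mul_inv_cancel₀ hi, one_smul, add_sub_cancel]
  have := slope_mem_of_dirDeriv_mem (f := f) (f' := f') (z := y i) (q := q) hi hW₁c hW₁o
    (fun r hr => hf _ (hA'A (hseg r hr)).2 _)
    (fun r hr => hAB (mk_mem_prod (hA'A (hseg r hr)).1 hqi))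
  rw [hxq] at this
  exact hW₁W this

end RealCalculus

/-! ### Elementary properties of directional derivatives -/

section DirDeriv

variable {𝕜 : Type*} [RCLike 𝕜] {E F : Type*} [AddCommGroup E] [Module 𝕜 E]
  [AddCommGroup F] [Module 𝕜 F] [TopologicalSpace F]

theorem HasDirDeriv.unique [T2Space F] {f : E → F} {x y : E} {d d' : F}
    (h : HasDirDeriv 𝕜 f x y d) (h' : HasDirDeriv 𝕜 f x y d') : d = d' :=
  tendsto_nhds_unique h h'

theorem hasDirDeriv_zero (f : E → F) (x : E) : HasDirDeriv 𝕜 f x 0 0 := by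
  simpa [HasDirDeriv] using (tendsto_const_nhds : Tendsto (fun _ : 𝕜 => (0 : F)) (𝓝[≠] 0) (𝓝 0))

theorem HasDirDeriv.add [ContinuousAdd F] {f g : E → F} {x y : E} {d d' : F}
    (h : HasDirDeriv 𝕜 f x y d) (h' : HasDirDeriv 𝕜 g x y d') :
    HasDirDeriv 𝕜 (fun z => f z + g z) x y (d + d') := by
  refine (Tendsto.add h h').congr fun s => ?_
  rw [← smul_add]
  congr 1
  exact (add_sub_add_comm _ _ _ _).symm

theorem HasDirDeriv.const_smul [ContinuousConstSMul 𝕜 F] {f : E → F} {x y : E} {d : F}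
    (h : HasDirDeriv 𝕜 f x y d) (r : 𝕜) : HasDirDeriv 𝕜 (fun z => r • f z) x y (r • d) := by
  refine (Tendsto.const_smul h r).congr fun s => ?_
  rw [← smul_sub, smul_comm]

theorem HasDirDeriv.congr_of_eventuallyEq [TopologicalSpace E] [ContinuousAdd E]
    [ContinuousSMul 𝕜 E] {f g : E → F} {x y : E} {d : F} (h : HasDirDeriv 𝕜 f x y d)
    (hfg : g =ᶠ[𝓝 x] f) : HasDirDeriv 𝕜 g x y d := by
  have ht : Tendsto (fun s : 𝕜 => x + s • y) (𝓝[≠] 0) (𝓝 x) := by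
    have : Tendsto (fun s : 𝕜 => x + s • y) (𝓝 0) (𝓝 (x + (0 : 𝕜) • y)) :=
      (show Continuous fun s : 𝕜 => x + s • y by fun_prop).tendsto 0
    rw [zero_smul, add_zero] at this
    exact this.mono_left nhdsWithin_le_nhds
  refine Tendsto.congr' ?_ h
  filter_upwards [ht.eventually hfg] with s hs
  rw [hs, hfg.self_of_nhds]

end DirDeriv

/-! ### Multilinearity of the iterated differentials -/

section Multilinear

variable {E : Type*} [AddCommGroup E] [Module ℝ E] [TopologicalSpace E]
  {F : Type*} [AddCommGroup F] [Module ℝ F] [TopologicalSpace F]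

/-- On `U`, the map `d j` is the `j`-th iterated differential of `d 0`, for all `j`, and all of them
are continuous. Thus `f` is smooth on `U` if and only if `f = d 0` for such a family. -/
structure IsDifferentialFamily (d : (j : ℕ) → E → (Fin j → E) → F) (U : Set E) : Prop where
  hasDirDeriv : ∀ (j : ℕ), ∀ x ∈ U, ∀ y : Fin (j + 1) → E,
    HasDirDeriv ℝ (fun z => d j z (Fin.init y)) x (y (Fin.last j)) (d (j + 1) x y)
  continuousOn : ∀ j : ℕ, ContinuousOn (fun p : E × (Fin j → E) => d j p.1 p.2) (U ×ˢ univ)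

namespace IsDifferentialFamily

variable {d : (j : ℕ) → E → (Fin j → E) → F} {U : Set E}

theorem hasDirDeriv_snoc (hd : IsDifferentialFamily d U) {j : ℕ} {x : E} (hx : x ∈ U)
    (y : Fin j → E) (w : E) :
    HasDirDeriv ℝ (fun z => d j z y) x w (d (j + 1) x (Fin.snoc y w)) := by
  simpa using hd.hasDirDeriv j x hx (Fin.snoc y w)

theorem continuousOn_snoc (hd : IsDifferentialFamily d U) {j : ℕ} (y : Fin j → E) :
    ContinuousOn (fun p : E × E => d (j + 1) p.1 (Fin.snoc y p.2)) (U ×ˢ univ) := by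
  refine (hd.continuousOn (j + 1)).comp
    (f := fun p : E × E => (p.1, (Fin.snoc y p.2 : Fin (j + 1) → E))) ?_
    fun p hp => ⟨hp.1, mem_univ _⟩
  refine Continuous.continuousOn (continuous_fst.prodMk (continuous_pi fun i => ?_))
  refine Fin.lastCases ?_ (fun i => ?_) i
  · simpa using continuous_snd
  · simpa using continuous_const

end IsDifferentialFamily

variable [IsTopologicalAddGroup E] [ContinuousSMul ℝ E]

theorem tendsto_add_smul_nhdsNE_zero (x y : E) :
    Tendsto (fun s : ℝ => x + s • y) (𝓝[≠] 0) (𝓝 x) := by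
  have : Tendsto (fun s : ℝ => x + s • y) (𝓝 0) (𝓝 (x + (0 : ℝ) • y)) :=
    (show Continuous fun s : ℝ => x + s • y by fun_prop).tendsto 0
  rw [zero_smul, add_zero] at this
  exact this.mono_left nhdsWithin_le_nhds

variable [LocallyConvexSpace ℝ E]
  [IsTopologicalAddGroup F] [ContinuousSMul ℝ F] [LocallyConvexSpace ℝ F] [T2Space F]

theorem dirDeriv_add {f : E → F} {f' : E → E → F} {U : Set E} (hU : IsOpen U)
    (hf : ∀ x ∈ U, ∀ y, HasDirDeriv ℝ f x y (f' x y))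
    (hf' : ContinuousOn (fun p : E × E => f' p.1 p.2) (U ×ˢ univ)) {x : E} (hx : x ∈ U)
    (a b : E) : f' x (a + b) = f' x a + f' x b := by
  have h1 : Tendsto (fun s : ℝ => s⁻¹ • (f (x + s • (a + b)) - f (x + s • a))) (𝓝[≠] 0)
      (𝓝 (f' x b)) := by
    refine tendsto_slope_of_dirDeriv hU hf hf' hx (tendsto_add_smul_nhdsNE_zero _ _)
      (tendsto_add_smul_nhdsNE_zero _ _) self_mem_nhdsWithin ?_
    refine tendsto_const_nhds.congr' ?_
    filter_upwards [self_mem_nhdsWithin] with s hs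
    rw [smul_add, ← add_assoc, add_sub_cancel_left, smul_smul, inv_mul_cancel₀ hs, one_smul]
  refine (hf x hx (a + b)).unique ((Tendsto.add (hf x hx a) h1).congr fun s => ?_)
  rw [← smul_add]
  congr 1
  abel

theorem dirDeriv_smul {f : E → F} {f' : E → E → F} {U : Set E} (hU : IsOpen U)
    (hf : ∀ x ∈ U, ∀ y, HasDirDeriv ℝ f x y (f' x y))
    (hf' : ContinuousOn (fun p : E × E => f' p.1 p.2) (U ×ˢ univ)) {x : E} (hx : x ∈ U)
    (r : ℝ) (a : E) : f' x (r • a) = r • f' x a := by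
  rcases eq_or_ne r 0 with rfl | hr
  · rw [zero_smul, zero_smul]
    exact (hf x hx 0).unique (hasDirDeriv_zero f x)
  · have h1 : Tendsto (fun s : ℝ => (s * r)⁻¹ • (f (x + s • r • a) - f x)) (𝓝[≠] 0)
        (𝓝 (f' x a)) := by
      refine tendsto_slope_of_dirDeriv hU hf hf' hx (tendsto_add_smul_nhdsNE_zero _ _)
        tendsto_const_nhds ?_ ?_
      · filter_upwards [self_mem_nhdsWithin] with s hs using mul_ne_zero hs hr
      · refine tendsto_const_nhds.congr' ?_
        filter_upwards [self_mem_nhdsWithin] with s hs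
        rw [add_sub_cancel_left, smul_smul s r, smul_smul, inv_mul_cancel₀ (mul_ne_zero hs hr),
          one_smul]
    refine (hf x hx (r • a)).unique ((h1.const_smul r).congr fun s => ?_)
    rw [smul_smul, mul_inv, mul_comm s⁻¹, ← mul_assoc, mul_inv_cancel₀ hr, one_mul]

namespace IsDifferentialFamily

variable {d : (j : ℕ) → E → (Fin j → E) → F} {U : Set E}

/-- Additivity in the last direction is the strict chain rule; in the others, it is inherited from
the previous differential by uniqueness of directional derivatives. -/
theorem map_update_add (hd : IsDifferentialFamily d U) (hU : IsOpen U) {j : ℕ} {x : E}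
    (hx : x ∈ U) (y : Fin j → E) (i : Fin j) (a b : E) :
    d j x (Function.update y i (a + b)) =
      d j x (Function.update y i a) + d j x (Function.update y i b) := by
  induction j generalizing x with
  | zero => exact i.elim0
  | succ j ih =>
    refine Fin.lastCases ?_ (fun i => ?_) i
    · have := dirDeriv_add hU (fun x hx w => hd.hasDirDeriv_snoc hx (Fin.init y) w)
        (hd.continuousOn_snoc (Fin.init y)) hx a b
      have hs : ∀ w, Fin.snoc (Fin.init y) w = Function.update y (Fin.last j) w := by
        intro w
        rw [← Fin.update_snoc_last (x := y (Fin.last j)), Fin.snoc_init_self]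
      simpa only [hs] using this
    · have h := fun w => hd.hasDirDeriv j x hx (Function.update y i.castSucc w)
      have hl : ∀ w, Function.update y i.castSucc w (Fin.last j) = y (Fin.last j) := fun w =>
        Function.update_of_ne (Fin.castSucc_lt_last i).ne' _ _
      simp only [Fin.init_update_castSucc, hl] at h
      refine (h (a + b)).unique (((h a).add (h b)).congr_of_eventuallyEq ?_)
      filter_upwards [hU.mem_nhds hx] with z hz using ih hz _ _

theorem map_update_smul (hd : IsDifferentialFamily d U) (hU : IsOpen U) {j : ℕ} {x : E}
    (hx : x ∈ U) (y : Fin j → E) (i : Fin j) (r : ℝ) (a : E) :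
    d j x (Function.update y i (r • a)) = r • d j x (Function.update y i a) := by
  induction j generalizing x with
  | zero => exact i.elim0
  | succ j ih =>
    refine Fin.lastCases ?_ (fun i => ?_) i
    · have := dirDeriv_smul hU (fun x hx w => hd.hasDirDeriv_snoc hx (Fin.init y) w)
        (hd.continuousOn_snoc (Fin.init y)) hx r a
      have hs : ∀ w, Fin.snoc (Fin.init y) w = Function.update y (Fin.last j) w := by
        intro w
        rw [← Fin.update_snoc_last (x := y (Fin.last j)), Fin.snoc_init_self]
      simpa only [hs] using this
    · have h := fun w => hd.hasDirDeriv j x hx (Function.update y i.castSucc w)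
      have hl : ∀ w, Function.update y i.castSucc w (Fin.last j) = y (Fin.last j) := fun w =>
        Function.update_of_ne (Fin.castSucc_lt_last i).ne' _ _
      simp only [Fin.init_update_castSucc, hl] at h
      refine (h (r • a)).unique (((h a).const_smul r).congr_of_eventuallyEq ?_)
      filter_upwards [hU.mem_nhds hx] with z hz using ih hz _ _

end IsDifferentialFamily

end Multilinear

/-! ### Calculus of curves -/

section CurveDeriv

variable {E : Type*} [AddCommGroup E] [Module ℝ E] [TopologicalSpace E]
  {F : Type*} [AddCommGroup F] [Module ℝ F] [TopologicalSpace F]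
  {t : unitInterval}

theorem HasCurveDerivAt.unique [T2Space E] {c : unitInterval → E} {v v' : E}
    (h : HasCurveDerivAt c v t) (h' : HasCurveDerivAt c v' t) : v = v' :=
  tendsto_nhds_unique h h'

theorem hasCurveDerivAt_const (x : E) (t : unitInterval) :
    HasCurveDerivAt (fun _ => x) 0 t := by
  simpa [HasCurveDerivAt] using
    (tendsto_const_nhds : Tendsto (fun _ : unitInterval => (0 : E)) (𝓝[≠] t) (𝓝 0))

theorem HasCurveDerivAt.congr_of_eventuallyEq {c c' : unitInterval → E} {v : E}
    (h : HasCurveDerivAt c v t) (hc : c' =ᶠ[𝓝 t] c) : HasCurveDerivAt c' v t := by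
  refine Tendsto.congr' ?_ h
  filter_upwards [nhdsWithin_le_nhds hc] with s hs
  rw [hs, hc.self_of_nhds]

theorem HasCurveDerivAt.add [ContinuousAdd E] {c c' : unitInterval → E} {v v' : E}
    (h : HasCurveDerivAt c v t) (h' : HasCurveDerivAt c' v' t) :
    HasCurveDerivAt (fun s => c s + c' s) (v + v') t := by
  refine (Tendsto.add h h').congr fun s => ?_
  rw [← smul_add, add_sub_add_comm]

theorem HasCurveDerivAt.map (L : E →L[ℝ] F) {c : unitInterval → E} {v : E}
    (h : HasCurveDerivAt c v t) : HasCurveDerivAt (fun s => L (c s)) (L v) t := by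
  refine ((L.continuous.tendsto v).comp h).congr fun s => ?_
  simp

theorem HasCurveDerivAt.prodMk {c : unitInterval → E} {c' : unitInterval → F} {v : E} {v' : F}
    (h : HasCurveDerivAt c v t) (h' : HasCurveDerivAt c' v' t) :
    HasCurveDerivAt (fun s => (c s, c' s)) (v, v') t :=
  (Tendsto.prodMk_nhds h h').congr fun s => by simp

theorem unitInterval_sub_ne_zero_eventually (t : unitInterval) :
    ∀ᶠ s : unitInterval in 𝓝[≠] t, (s : ℝ) - (t : ℝ) ≠ 0 := by
  filter_upwards [self_mem_nhdsWithin] with s hs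
  exact sub_ne_zero.2 fun h => hs (Subtype.ext h)

theorem tendsto_unitInterval_sub (t : unitInterval) :
    Tendsto (fun s : unitInterval => (s : ℝ) - (t : ℝ)) (𝓝[≠] t) (𝓝[≠] 0) := by
  refine tendsto_nhdsWithin_iff.2 ⟨?_, unitInterval_sub_ne_zero_eventually t⟩
  have : Tendsto (fun s : unitInterval => (s : ℝ) - (t : ℝ)) (𝓝 t) (𝓝 ((t : ℝ) - t)) :=
    (show Continuous fun s : unitInterval => (s : ℝ) - (t : ℝ) by fun_prop).tendsto t
  rw [sub_self] at this
  exact this.mono_left nhdsWithin_le_nhds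

end CurveDeriv

section CrCurve

variable {E : Type*} [AddCommGroup E] [Module ℝ E] [TopologicalSpace E]
  {F : Type*} [AddCommGroup F] [Module ℝ F] [TopologicalSpace F]
  {J : Set unitInterval}

theorem isCrCurveOn_zero {c : unitInterval → E} : IsCrCurveOn 0 c J ↔ ContinuousOn c J := by
  constructor
  · rintro ⟨D, rfl, -, h⟩
    exact h 0 (by simp)
  · intro h
    refine ⟨fun _ => c, rfl, fun j hj => ?_, fun j hj => h⟩
    simp at hj

theorem isCrCurveOn_succ {m : ℕ} {c : unitInterval → E} :
    IsCrCurveOn ((m + 1 : ℕ) : ℕ∞) c J ↔ ContinuousOn c J ∧ ∃ c' : unitInterval → E,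
      (∀ t ∈ J, HasCurveDerivAt c (c' t) t) ∧ IsCrCurveOn m c' J := by
  constructor
  · rintro ⟨D, rfl, h1, h2⟩
    refine ⟨h2 0 (by simp), D 1, h1 0 (by simp), fun j => D (j + 1), rfl, fun j hj => ?_,
      fun j hj => ?_⟩
    · refine h1 (j + 1) ?_
      norm_cast at hj ⊢
      lia
    · refine h2 (j + 1) ?_
      norm_cast at hj ⊢
      lia
  · rintro ⟨hc, c', hc', D, rfl, h1, h2⟩
    refine ⟨fun j => Nat.casesOn j c D, rfl, fun j hj => ?_, fun j hj => ?_⟩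
    · cases j with
      | zero => exact hc'
      | succ j =>
        refine h1 j ?_
        norm_cast at hj ⊢
        lia
    · cases j with
      | zero => exact hc
      | succ j =>
        refine h2 j ?_
        norm_cast at hj ⊢
        lia

theorem IsCrCurveOn.continuousOn {r : ℕ∞} {c : unitInterval → E} (h : IsCrCurveOn r c J) :
    ContinuousOn c J := by
  obtain ⟨D, rfl, -, h⟩ := h
  exact h 0 (by simp)

theorem IsCrCurveOn.of_le {r r' : ℕ∞} {c : unitInterval → E} (h : IsCrCurveOn r c J)
    (hr : r' ≤ r) : IsCrCurveOn r' c J := by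
  obtain ⟨D, h0, h1, h2⟩ := h
  exact ⟨D, h0, fun j hj => h1 j (hj.trans hr), fun j hj => h2 j (hj.trans hr)⟩

theorem IsCrCurveOn.mono {r : ℕ∞} {c : unitInterval → E} (h : IsCrCurveOn r c J)
    {J' : Set unitInterval} (hJ : J' ⊆ J) : IsCrCurveOn r c J' := by
  obtain ⟨D, h0, h1, h2⟩ := h
  exact ⟨D, h0, fun j hj t ht => h1 j hj t (hJ ht), fun j hj => (h2 j hj).mono hJ⟩

theorem IsCrCurveOn.add [ContinuousAdd E] {r : ℕ∞} {c c' : unitInterval → E}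
    (h : IsCrCurveOn r c J) (h' : IsCrCurveOn r c' J) :
    IsCrCurveOn r (fun t => c t + c' t) J := by
  obtain ⟨D, rfl, h1, h2⟩ := h
  obtain ⟨D', rfl, h1', h2'⟩ := h'
  exact ⟨fun j t => D j t + D' j t, rfl, fun j hj t ht => (h1 j hj t ht).add (h1' j hj t ht),
    fun j hj => (h2 j hj).add (h2' j hj)⟩

theorem isCrCurveOn_const (r : ℕ∞) (x : E) : IsCrCurveOn r (fun _ => x) J := by
  refine ⟨fun j => Nat.casesOn j (fun _ => x) fun _ _ => 0, rfl, fun j _ t _ => ?_,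
    fun j _ => ?_⟩
  · cases j <;> exact hasCurveDerivAt_const _ _
  · cases j <;> exact continuousOn_const

theorem IsCrCurveOn.sum [ContinuousAdd E] {r : ℕ∞} {ι : Type*} (S : Finset ι)
    {c : ι → unitInterval → E} (h : ∀ i ∈ S, IsCrCurveOn r (c i) J) :
    IsCrCurveOn r (fun t => ∑ i ∈ S, c i t) J := by
  classical
  induction S using Finset.induction_on with
  | empty => simpa using isCrCurveOn_const r (0 : E)
  | insert a S ha ih =>
    simp only [Finset.sum_insert ha]
    exact (h a (Finset.mem_insert_self a S)).add
      (ih fun i hi => h i (Finset.mem_insert_of_mem hi))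

theorem IsCrCurveOn.prodMk {r : ℕ∞} {c : unitInterval → E} {c' : unitInterval → F}
    (h : IsCrCurveOn r c J) (h' : IsCrCurveOn r c' J) :
    IsCrCurveOn r (fun t => (c t, c' t)) J := by
  obtain ⟨D, rfl, h1, h2⟩ := h
  obtain ⟨D', rfl, h1', h2'⟩ := h'
  exact ⟨fun j t => (D j t, D' j t), rfl,
    fun j hj t ht => (h1 j hj t ht).prodMk (h1' j hj t ht),
    fun j hj => (h2 j hj).prodMk (h2' j hj)⟩

/-- By uniqueness of derivatives, the derivatives witnessing the classes `C^m` for different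
finite `m` fit together. -/
theorem isCrCurveOn_top [T2Space E] {c : unitInterval → E} (hJ : IsOpen J)
    (h : ∀ m : ℕ, IsCrCurveOn m c J) : IsCrCurveOn ⊤ c J := by
  choose D h0 h1 h2 using h
  have key : ∀ j m m' : ℕ, j ≤ m → j ≤ m' → EqOn (D m j) (D m' j) J := by
    intro j
    induction j with
    | zero => intro m m' _ _ t _; rw [h0, h0]
    | succ j ih =>
      intro m m' hm hm' t ht
      have hD := h1 m j (by exact_mod_cast hm) t ht
      have hD' := h1 m' j (by exact_mod_cast hm') t ht
      refine hD.unique (hD'.congr_of_eventuallyEq ?_)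
      exact (ih m m' (by lia) (by lia)).eventuallyEq_of_mem (hJ.mem_nhds ht)
  refine ⟨fun j => D j j, h0 0, fun j _ t ht => ?_, fun j _ => h2 j j le_rfl⟩
  refine (h1 (j + 1) j le_rfl t ht).congr_of_eventuallyEq ?_
  exact (key j j (j + 1) le_rfl (by lia)).eventuallyEq_of_mem (hJ.mem_nhds ht)

end CrCurve

/-! ### Composition of smooth maps and curves -/

section Composition

variable {E : Type*} [AddCommGroup E] [Module ℝ E] [TopologicalSpace E]
  [IsTopologicalAddGroup E] [ContinuousSMul ℝ E] [LocallyConvexSpace ℝ E]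
  {F : Type*} [AddCommGroup F] [Module ℝ F] [TopologicalSpace F]
  [IsTopologicalAddGroup F] [ContinuousSMul ℝ F] [LocallyConvexSpace ℝ F] [T2Space F]
  {d : (j : ℕ) → E → (Fin j → E) → F} {U : Set E}

/-- The derivative of `s ↦ d^j f (c(s), v_1(s), …, v_j(s))`. -/
theorem IsDifferentialFamily.hasCurveDerivAt_comp (hd : IsDifferentialFamily d U)
    (hU : IsOpen U) {j : ℕ} {c : unitInterval → E} {v : Fin j → unitInterval → E}
    {t : unitInterval} {c' : E} {v' : Fin j → E} (hct : c t ∈ U) (hc : ContinuousAt c t)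
    (hv : ∀ i, ContinuousAt (v i) t) (hc' : HasCurveDerivAt c c' t)
    (hv' : ∀ i, HasCurveDerivAt (v i) (v' i) t) :
    HasCurveDerivAt (fun s => d j (c s) fun i => v i s)
      (d (j + 1) (c t) (Fin.snoc (fun i => v i t) c') +
        ∑ i, d j (c t) (Function.update (fun i => v i t) i (v' i))) t := by
  classical
  -- let only the arguments `v_i` with `i ∈ S` vary, and add the indices to `S` one by one
  have key : ∀ S : Finset (Fin j), HasCurveDerivAt
      (fun s => d j (c s) fun i => if i ∈ S then v i s else v i t)
      (d (j + 1) (c t) (Fin.snoc (fun i => v i t) c') +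
        ∑ i ∈ S, d j (c t) (Function.update (fun i => v i t) i (v' i))) t := by
    intro S
    induction S using Finset.induction_on with
    | empty =>
      simp only [Finset.notMem_empty, if_false, Finset.sum_empty, add_zero]
      exact tendsto_slope_of_dirDeriv hU
        (fun x hx w => hd.hasDirDeriv_snoc hx (fun i => v i t) w)
        (hd.continuousOn_snoc fun i => v i t) hct (hc.mono_left nhdsWithin_le_nhds)
        tendsto_const_nhds (unitInterval_sub_ne_zero_eventually t) hc'
    | insert a S ha ih =>
      rw [Finset.sum_insert ha, add_comm (d j (c t) _), ← add_assoc]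
      set vS : unitInterval → Fin j → E := fun s i => if i ∈ S then v i s else v i t with hvS
      have hvSt : vS t = fun i => v i t := by
        funext i
        simp [hvS]
      have hins : ∀ s, (fun i => if i ∈ insert a S then v i s else v i t) =
          Function.update (vS s) a (v a s) := by
        intro s
        funext i
        by_cases h : i = a
        · subst h; simp
        · simp [hvS, h]
      have hvSa : ∀ s, Function.update (vS s) a (v a t) = vS s := by
        intro s
        rw [Function.update_eq_self_iff]
        simp [hvS, ha]
      have hlim : Tendsto (fun s : unitInterval => d j (c s)
          (Function.update (vS s) a (((s : ℝ) - t)⁻¹ • (v a s - v a t)))) (𝓝[≠] t)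
          (𝓝 (d j (c t) (Function.update (fun i => v i t) a (v' a)))) := by
        have hcont := (hd.continuousOn j).continuousAt
          ((hU.prod isOpen_univ).mem_nhds (show (c t, Function.update (fun i => v i t) a (v' a)) ∈
            U ×ˢ univ from ⟨hct, mem_univ _⟩))
        refine hcont.tendsto.comp ((hc.mono_left nhdsWithin_le_nhds).prodMk_nhds
          (tendsto_pi_nhds.2 fun i => ?_))
        change Tendsto (fun s => Function.update (vS s) a (((s : ℝ) - t)⁻¹ • (v a s - v a t)) i)
          _ (𝓝 (Function.update (fun i => v i t) a (v' a) i))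
        by_cases h : i = a
        · subst h
          simpa [HasCurveDerivAt] using hv' i
        · simp only [ne_eq, h, not_false_eq_true, Function.update_of_ne, hvS]
          split_ifs
          · exact (hv i).mono_left nhdsWithin_le_nhds
          · exact tendsto_const_nhds
      refine (Tendsto.add ih hlim).congr' ?_
      filter_upwards [unitInterval_sub_ne_zero_eventually t,
        nhdsWithin_le_nhds (hc (hU.mem_nhds hct))] with s hs hsU
      have hstep : d j (c s) (Function.update (vS s) a (v a s)) = d j (c s) (vS s) +
          ((s : ℝ) - t) • d j (c s) (Function.update (vS s) a (((s : ℝ) - t)⁻¹ •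
            (v a s - v a t))) := by
        conv_lhs => rw [← add_sub_cancel (v a t) (v a s), ← smul_inv_smul₀ hs (v a s - v a t)]
        rw [hd.map_update_add hU hsU, hd.map_update_smul hU hsU _ _ ((s : ℝ) - t), hvSa s]
      rw [hins, hins, hvSa t, hstep, add_sub_right_comm, smul_add, inv_smul_smul₀ hs]
  simpa using key Finset.univ

/-- Composites of smooth maps and `C^m`-curves are `C^m`. The iterated differentials are treated
together, because the derivative of `s ↦ d^j f (c(s), v(s))` involves both `d^j f` and
`d^{j+1} f`. -/
theorem IsDifferentialFamily.isCrCurveOn_comp (hd : IsDifferentialFamily d U) (hU : IsOpen U)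
    {J : Set unitInterval} (hJ : IsOpen J) (m : ℕ) {j : ℕ} {c : unitInterval → E}
    {v : Fin j → unitInterval → E} (hcU : ∀ t ∈ J, c t ∈ U) (hc : IsCrCurveOn m c J)
    (hv : ∀ i, IsCrCurveOn m (v i) J) :
    IsCrCurveOn m (fun t => d j (c t) fun i => v i t) J := by
  induction m generalizing j c v with
  | zero =>
    rw [Nat.cast_zero, isCrCurveOn_zero]
    exact (hd.continuousOn j).comp (hc.continuousOn.prodMk
      (continuousOn_pi.2 fun i => (hv i).continuousOn)) fun t ht => ⟨hcU t ht, mem_univ _⟩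
  | succ m ih =>
    have hle : (m : ℕ∞) ≤ ((m + 1 : ℕ) : ℕ∞) := by exact_mod_cast m.le_succ
    obtain ⟨hcc, c', hc', hcm⟩ := isCrCurveOn_succ.1 hc
    choose hvc v' hv' hvm using fun i => isCrCurveOn_succ.1 (hv i)
    refine isCrCurveOn_succ.2 ⟨?_, _, fun t ht => hd.hasCurveDerivAt_comp hU (hcU t ht)
      (hcc.continuousAt (hJ.mem_nhds ht)) (fun i => (hvc i).continuousAt (hJ.mem_nhds ht))
      (hc' t ht) fun i => hv' i t ht, ?_⟩
    · exact (ih hcU (hc.of_le hle) fun i => (hv i).of_le hle).continuousOn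
    · refine IsCrCurveOn.add ?_ (IsCrCurveOn.sum _ fun i _ => ?_)
      · have := ih (j := j + 1) (v := Fin.snoc (α := fun _ => unitInterval → E) v c') hcU
          (hc.of_le hle) fun i => by
            refine Fin.lastCases ?_ (fun i => ?_) i
            · simpa using hcm
            · simpa using (hv i).of_le hle
        convert this using 3 with t
        funext i
        refine Fin.lastCases ?_ (fun i => ?_) i <;> simp
      · have := ih (v := Function.update v i (v' i)) hcU (hc.of_le hle) fun l => by
          by_cases h : l = i
          · subst h; simpa using hvm l
          · simpa [h] using (hv l).of_le hle
        convert this using 3 with t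
        funext l
        by_cases h : l = i
        · subst h; simp
        · simp [h]

end Composition

/-! ### Curves with vanishing derivative -/

section Constant

variable {E : Type*} [AddCommGroup E] [Module ℝ E] [TopologicalSpace E]
  [IsTopologicalAddGroup E] [ContinuousSMul ℝ E] [LocallyConvexSpace ℝ E] [T1Space E]

theorem eventually_eq_of_hasCurveDerivAt_zero {c : unitInterval → E} {J : Set unitInterval}
    (hJ : IsOpen J) (hc : ∀ t ∈ J, HasCurveDerivAt c 0 t) {t : unitInterval} (ht : t ∈ J) :
    ∀ᶠ s in 𝓝 t, c s = c t := by
  obtain ⟨ε, hε, hball⟩ := Metric.isOpen_iff.1 hJ t ht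
  filter_upwards [Metric.ball_mem_nhds t hε] with s hs
  by_contra hne
  obtain ⟨φ, hφ⟩ := geometric_hahn_banach_point_point hne
  -- the real curve `φ ∘ c`, extended to `ℝ`, has zero derivative on an interval around `t`
  set g : ℝ → ℝ := fun r => φ (c (projIcc 0 1 zero_le_one r)) with hg
  set S : Set ℝ := Icc 0 1 ∩ Metric.ball (t : ℝ) ε with hS
  have hder : ∀ r ∈ S, HasDerivWithinAt g 0 S r := by
    rintro r ⟨hr, hrb⟩
    have h1 := (hc ⟨r, hr⟩ (hball (by simpa [Subtype.dist_eq] using hrb))).map φ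
    rw [hasDerivWithinAt_iff_tendsto_slope]
    have h2 : Tendsto (fun x : ℝ => projIcc 0 1 zero_le_one x) (𝓝[S \ {r}] r)
        (𝓝[≠] (⟨r, hr⟩ : unitInterval)) := by
      refine tendsto_nhdsWithin_iff.2 ⟨?_, ?_⟩
      · have : Tendsto (fun x : ℝ => projIcc 0 1 zero_le_one x) (𝓝 r)
            (𝓝 (projIcc 0 1 zero_le_one r)) := continuous_projIcc.tendsto r
        rw [projIcc_of_mem zero_le_one hr] at this
        exact this.mono_left nhdsWithin_le_nhds
      · filter_upwards [self_mem_nhdsWithin] with x hx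
        rw [projIcc_of_mem zero_le_one hx.1.1]
        exact fun h => hx.2 (congrArg Subtype.val h)
    rw [map_zero] at h1
    refine (Tendsto.comp h1 h2).congr' ?_
    filter_upwards [self_mem_nhdsWithin] with x hx
    simp only [Function.comp_apply, slope, vsub_eq_sub, hg]
    rw [projIcc_of_mem zero_le_one hx.1.1, projIcc_of_mem zero_le_one hr]
  have hconv : Convex ℝ S := (convex_Icc 0 1).inter (convex_ball _ _)
  have := hconv.norm_image_sub_le_of_norm_hasDerivWithin_le (f' := fun _ => 0) (C := 0) hder
    (by simp) (x := (t : ℝ)) (y := (s : ℝ)) ⟨t.2, Metric.mem_ball_self hε⟩ ⟨s.2, hs⟩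
  rw [zero_mul, norm_le_zero_iff, sub_eq_zero] at this
  simp only [hg, projIcc_val] at this
  exact hφ.ne this

end Constant

/-! ### Tangency of curves in manifolds and Lie groups -/

section Smooth

variable {E : Type*} [AddCommGroup E] [Module ℝ E] [TopologicalSpace E]
  {F : Type*} [AddCommGroup F] [Module ℝ F] [TopologicalSpace F]

theorem IsCrOn.exists_isDifferentialFamily {f : E → F} {U : Set E} (h : IsCrOn ℝ ⊤ f U) :
    ∃ d : (j : ℕ) → E → (Fin j → E) → F, (∀ x y, d 0 x y = f x) ∧ IsDifferentialFamily d U := by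
  obtain ⟨d, h0, h1, h2⟩ := h
  exact ⟨d, h0, fun j => h1 j le_top, fun j => h2 j le_top⟩

variable [LocallyConvexSpace ℝ E]
  [IsTopologicalAddGroup F] [ContinuousSMul ℝ F] [LocallyConvexSpace ℝ F] [T2Space F]

theorem IsCrOn.tendsto_slope_zero {ι : Type*} {l : Filter ι} {f : E → F} {U : Set E}
    (hf : IsCrOn ℝ ⊤ f U) (hU : IsOpen U) {x y : ι → E} {h : ι → ℝ} {x₀ : E} (hx₀ : x₀ ∈ U)
    (hx : Tendsto x l (𝓝 x₀)) (hy : Tendsto y l (𝓝 x₀)) (hh : ∀ᶠ i in l, h i ≠ 0)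
    (hq : Tendsto (fun i => (h i)⁻¹ • (x i - y i)) l (𝓝 0)) :
    Tendsto (fun i => (h i)⁻¹ • (f (x i) - f (y i))) l (𝓝 0) := by
  obtain ⟨d, h0, hd⟩ := hf.exists_isDifferentialFamily
  have hdir : ∀ x ∈ U, ∀ w, HasDirDeriv ℝ f x w (d 1 x (Fin.snoc 0 w)) := fun x hx w => by
    simpa only [h0] using hd.hasDirDeriv_snoc hx (0 : Fin 0 → E) w
  have := tendsto_slope_of_dirDeriv (f' := fun x w => d 1 x (Fin.snoc 0 w)) hU hdir
    (hd.continuousOn_snoc 0) hx₀ hx hy hh hq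
  rwa [(hdir x₀ hx₀ 0).unique (hasDirDeriv_zero f x₀)] at this

end Smooth

section Tangency

variable (E : Type*) [AddCommGroup E] [Module ℝ E] [TopologicalSpace E]
  {M : Type*} [TopologicalSpace M] [ChartedSpace E M]

/-- The curves `p` and `q` in a manifold are tangent at `t`: in each chart, their difference is
`o(s - t)`. Neither of them is required to be differentiable at `t`. -/
structure IsTangentAt (p q : unitInterval → M) (t : unitInterval) : Prop where
  continuousAt_left : ContinuousAt p t
  continuousAt_right : ContinuousAt q t
  eq : p t = q t
  tendsto : ∀ e ∈ atlas E M, p t ∈ e.source →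
    Tendsto (fun s : unitInterval => ((s : ℝ) - t)⁻¹ • (e (p s) - e (q s))) (𝓝[≠] t) (𝓝 0)

end Tangency

section LieGroup

section Domains

variable {E G : Type*} [TopologicalSpace E] [TopologicalSpace G] [Group G]

theorem isOpen_mul_domain [ContinuousMul G] (e e' e'' : OpenPartialHomeomorph G E) :
    IsOpen {p : E × E | p.1 ∈ e.target ∧ p.2 ∈ e'.target ∧
      e.symm p.1 * e'.symm p.2 ∈ e''.source} := by
  have hc : ContinuousOn (fun p : E × E => e.symm p.1 * e'.symm p.2) (e.target ×ˢ e'.target) :=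
    (e.continuousOn_symm.comp continuousOn_fst fun p hp => hp.1).mul
      (e'.continuousOn_symm.comp continuousOn_snd fun p hp => hp.2)
  have := hc.isOpen_inter_preimage (e.open_target.prod e'.open_target) e''.open_source
  convert this using 1
  ext p
  simp [and_assoc]

theorem isOpen_inv_domain [ContinuousInv G] (e e' : OpenPartialHomeomorph G E) :
    IsOpen {x : E | x ∈ e.target ∧ (e.symm x)⁻¹ ∈ e'.source} :=
  e.continuousOn_symm.inv.isOpen_inter_preimage e.open_target e'.open_source

end Domains

variable {E : Type*} [AddCommGroup E] [Module ℝ E] [TopologicalSpace E]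
  {G : Type*} [Group G] [TopologicalSpace G] [ChartedSpace E G]

namespace IsLCLieGroup

/-- To verify tangency, a single chart suffices. -/
theorem isTangentAt_of_chart (h : IsLCLieGroup ℝ E G) {p q : unitInterval → G}
    {t : unitInterval} (hp : ContinuousAt p t) (hq : ContinuousAt q t) (hpq : p t = q t)
    {e : OpenPartialHomeomorph G E} (he : e ∈ atlas E G) (hpe : p t ∈ e.source)
    (hlim : Tendsto (fun s : unitInterval => ((s : ℝ) - t)⁻¹ • (e (p s) - e (q s)))
      (𝓝[≠] t) (𝓝 0)) : IsTangentAt E p q t := by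
  have := h.model_isTopologicalAddGroup
  have := h.model_continuousSMul
  have := h.model_locallyConvex
  have := h.model_t2
  refine ⟨hp, hq, hpq, fun e' he' hpe' => ?_⟩
  have hqe : q t ∈ e.source := hpq ▸ hpe
  have hep : Tendsto (fun s => e (p s)) (𝓝[≠] t) (𝓝 (e (p t))) :=
    ((e.continuousAt hpe).comp hp).mono_left nhdsWithin_le_nhds
  have heq : Tendsto (fun s => e (q s)) (𝓝[≠] t) (𝓝 (e (p t))) := by
    rw [hpq]
    exact ((e.continuousAt hqe).comp hq).mono_left nhdsWithin_le_nhds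
  refine ((h.smooth_transition e he e' he').tendsto_slope_zero
    (e.isOpen_inter_preimage_symm e'.open_source)
    ⟨e.map_source hpe, by simpa [e.left_inv hpe] using hpe'⟩ hep heq
    (unitInterval_sub_ne_zero_eventually t) hlim).congr' ?_
  filter_upwards [nhdsWithin_le_nhds (hp (e.open_source.mem_nhds hpe)),
    nhdsWithin_le_nhds (hq (e.open_source.mem_nhds hqe))] with s hs hs'
  rw [e.left_inv hs, e.left_inv hs']

theorem isTangentAt_mul (h : IsLCLieGroup ℝ E G) {p q p' q' : unitInterval → G}
    {t : unitInterval} (hpq : IsTangentAt E p q t) (hpq' : IsTangentAt E p' q' t) :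
    IsTangentAt E (fun s => p s * p' s) (fun s => q s * q' s) t := by
  have := h.model_isTopologicalAddGroup
  have := h.model_continuousSMul
  have := h.model_locallyConvex
  have := h.model_t2
  have := h.isTopologicalGroup
  obtain ⟨hp, hq, heq, hlim⟩ := hpq
  obtain ⟨hp', hq', heq', hlim'⟩ := hpq'
  set e := chartAt E (p t)
  set e' := chartAt E (p' t)
  set e'' := chartAt E (p t * p' t)
  have hpe : p t ∈ e.source := mem_chart_source E _
  have hpe' : p' t ∈ e'.source := mem_chart_source E _
  have hpe'' : p t * p' t ∈ e''.source := mem_chart_source E _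
  have hqe : q t ∈ e.source := heq ▸ hpe
  have hqe' : q' t ∈ e'.source := heq' ▸ hpe'
  refine h.isTangentAt_of_chart (hp.mul hp') (hq.mul hq') (by simp only [heq, heq'])
    (chart_mem_atlas E (p t * p' t)) hpe'' ?_
  have h1 : Tendsto (fun s => (e (p s), e' (p' s))) (𝓝[≠] t) (𝓝 (e (p t), e' (p' t))) :=
    (((e.continuousAt hpe).comp hp).prodMk ((e'.continuousAt hpe').comp hp')).mono_left
      nhdsWithin_le_nhds
  have h2 : Tendsto (fun s => (e (q s), e' (q' s))) (𝓝[≠] t) (𝓝 (e (p t), e' (p' t))) := by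
    rw [heq, heq']
    exact (((e.continuousAt hqe).comp hq).prodMk ((e'.continuousAt hqe').comp hq')).mono_left
      nhdsWithin_le_nhds
  refine ((h.smooth_mul e (chart_mem_atlas E _) e' (chart_mem_atlas E _) e''
    (chart_mem_atlas E _)).tendsto_slope_zero (isOpen_mul_domain e e' e'')
    ⟨e.map_source hpe, e'.map_source hpe', by simpa [e.left_inv hpe, e'.left_inv hpe']⟩ h1 h2
    (unitInterval_sub_ne_zero_eventually t)
    (((hlim e (chart_mem_atlas E _) hpe).prodMk_nhds
      (hlim' e' (chart_mem_atlas E _) hpe')).congr fun s => by simp)).congr' ?_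
  filter_upwards [nhdsWithin_le_nhds (hp (e.open_source.mem_nhds hpe)),
    nhdsWithin_le_nhds (hq (e.open_source.mem_nhds hqe)),
    nhdsWithin_le_nhds (hp' (e'.open_source.mem_nhds hpe')),
    nhdsWithin_le_nhds (hq' (e'.open_source.mem_nhds hqe'))] with s h3 h4 h5 h6
  rw [e.left_inv h3, e.left_inv h4, e'.left_inv h5, e'.left_inv h6]

theorem isTangentAt_inv (h : IsLCLieGroup ℝ E G) {p q : unitInterval → G}
    {t : unitInterval} (hpq : IsTangentAt E p q t) :
    IsTangentAt E (fun s => (p s)⁻¹) (fun s => (q s)⁻¹) t := by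
  have := h.model_isTopologicalAddGroup
  have := h.model_continuousSMul
  have := h.model_locallyConvex
  have := h.model_t2
  have := h.isTopologicalGroup
  obtain ⟨hp, hq, heq, hlim⟩ := hpq
  set e := chartAt E (p t)
  set e' := chartAt E (p t)⁻¹
  have hpe : p t ∈ e.source := mem_chart_source E _
  have hpe' : (p t)⁻¹ ∈ e'.source := mem_chart_source E _
  have hqe : q t ∈ e.source := heq ▸ hpe
  refine h.isTangentAt_of_chart hp.inv hq.inv (by simp only [heq])
    (chart_mem_atlas E (p t)⁻¹) hpe' ?_
  have h1 : Tendsto (fun s => e (p s)) (𝓝[≠] t) (𝓝 (e (p t))) :=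
    ((e.continuousAt hpe).comp hp).mono_left nhdsWithin_le_nhds
  have h2 : Tendsto (fun s => e (q s)) (𝓝[≠] t) (𝓝 (e (p t))) := by
    rw [heq]
    exact ((e.continuousAt hqe).comp hq).mono_left nhdsWithin_le_nhds
  refine ((h.smooth_inv e (chart_mem_atlas E _) e' (chart_mem_atlas E _)).tendsto_slope_zero
    (isOpen_inv_domain e e') ⟨e.map_source hpe, by simpa [e.left_inv hpe]⟩ h1 h2
    (unitInterval_sub_ne_zero_eventually t) (hlim e (chart_mem_atlas E _) hpe)).congr' ?_
  filter_upwards [nhdsWithin_le_nhds (hp (e.open_source.mem_nhds hpe)),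
    nhdsWithin_le_nhds (hq (e.open_source.mem_nhds hqe))] with s h3 h4
  rw [e.left_inv h3, e.left_inv h4]

end IsLCLieGroup

/-! ### Uniqueness and smoothness of product integrals -/

variable (G) in
/-- The curve `s ↦ φ⁻¹(φ(1) + (s - t) v)` through `1`, where `φ` is the preferred chart at `1`. -/
def chartLine (v : E) (t s : unitInterval) : G :=
  (chartAt E (1 : G)).symm (chartAt E (1 : G) 1 + ((s : ℝ) - t) • v)

theorem chartLine_self (v : E) (t : unitInterval) : chartLine G v t t = 1 := by
  simp [chartLine]

theorem continuousAt_chartLine [IsTopologicalAddGroup E] [ContinuousSMul ℝ E] (v : E)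
    (t : unitInterval) : ContinuousAt (chartLine G v t) t := by
  refine ContinuousAt.comp_of_eq (y := chartAt E (1 : G) 1) ?_ ?_ (by simp)
  · exact (chartAt E (1 : G)).continuousAt_symm (mem_chart_target E 1)
  · exact Continuous.continuousAt (by fun_prop)

/-- The differential equation `η'(t) = η(t) · γ(t)`, as a statement on tangency: near `t`, the curve
`η` is tangent to a left translate of a curve through `1` which only depends on `γ(t)`. -/
theorem IsProductIntegral.isTangentAt (h : IsLCLieGroup ℝ E G) {r : ℕ∞} {γ : unitInterval → E}
    {η : unitInterval → G} (hη : IsProductIntegral ℝ r γ η) (t : unitInterval) :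
    IsTangentAt E η (fun s => η t * chartLine G (γ t) t s) t := by
  have := h.model_isTopologicalAddGroup
  have := h.model_continuousSMul
  have := h.isTopologicalGroup
  obtain ⟨w, h1, h2⟩ := hη.2.2 t
  refine h.isTangentAt_of_chart hη.1.1.continuousAt
    (continuousAt_const.mul (continuousAt_chartLine _ _)) (by simp [chartLine_self])
    (chart_mem_atlas E (η t)) (mem_chart_source E _) ?_
  have h3 := (Tendsto.sub h2 (h1.comp (tendsto_unitInterval_sub t)))
  rw [sub_self] at h3
  refine h3.congr fun s => ?_
  simp [chartLine, ← smul_sub]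

/-- For product integrals `η` and `ξ` of the same curve, `η ξ⁻¹` is tangent to a constant curve at
each `t`, whence it is constant. -/
theorem IsProductIntegral.unique (h : IsLCLieGroup ℝ E G) {r r' : ℕ∞} {γ : unitInterval → E}
    {η ξ : unitInterval → G} (hη : IsProductIntegral ℝ r γ η) (hξ : IsProductIntegral ℝ r' γ ξ) :
    η = ξ := by
  have := h.model_isTopologicalAddGroup
  have := h.model_continuousSMul
  have := h.model_locallyConvex
  have := h.model_t2
  have := h.isTopologicalGroup
  set ζ : unitInterval → G := fun t => η t * (ξ t)⁻¹ with hζ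
  have hζc : Continuous ζ := hη.1.1.mul hξ.1.1.inv
  have htan : ∀ t, IsTangentAt E ζ (fun _ => ζ t) t := by
    intro t
    have := h.isTangentAt_mul (hη.isTangentAt h t) (h.isTangentAt_inv (hξ.isTangentAt h t))
    simpa [mul_assoc] using this
  have hloc : IsLocallyConstant ζ := by
    refine (IsLocallyConstant.iff_eventually_eq _).2 fun t => ?_
    set e := chartAt E (ζ t)
    have hJ : IsOpen (ζ ⁻¹' e.source) := e.open_source.preimage hζc
    have ht : t ∈ ζ ⁻¹' e.source := mem_chart_source E (ζ t)
    filter_upwards [eventually_eq_of_hasCurveDerivAt_zero (c := fun s => e (ζ s)) hJ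
      (fun s hs => (htan s).tendsto e (chart_mem_atlas E _) hs) ht, hJ.mem_nhds ht] with s hs hs'
    exact e.injOn hs' ht hs
  funext t
  have hconst : ζ t = ζ 0 := hloc.apply_eq_of_preconnectedSpace t 0
  simp only [hζ, hη.2.1, hξ.2.1, inv_one, mul_one] at hconst
  exact mul_inv_eq_one.1 hconst

/-- Product integrals of smooth curves are smooth: in a chart, `η` solves a differential equation
`c' = f(c, γ)` with smooth right-hand side, so that `c` is `C^{m+1}` if it is `C^m`. -/
theorem IsProductIntegral.isCrManifoldCurve_top (h : IsLCLieGroup ℝ E G) {r : ℕ∞}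
    {γ : unitInterval → E} {η : unitInterval → G} (hη : IsProductIntegral ℝ r γ η)
    (hγ : IsCrCurveOn ⊤ γ univ) : IsCrManifoldCurve E ⊤ η := by
  have := h.model_isTopologicalAddGroup
  have := h.model_continuousSMul
  have := h.model_locallyConvex
  have := h.model_t2
  have := h.isTopologicalGroup
  refine ⟨hη.1.1, fun e he => ?_⟩
  set J := η ⁻¹' e.source with hJdef
  have hJ : IsOpen J := e.open_source.preimage hη.1.1
  set e₁ := chartAt E (1 : G) with he₁
  set c : unitInterval → E := fun t => e (η t) with hc
  obtain ⟨d, hd0, hd⟩ :=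
    (h.smooth_mul e he e₁ (chart_mem_atlas E _) e he).exists_isDifferentialFamily
  set U := {p : E × E | p.1 ∈ e.target ∧ p.2 ∈ e₁.target ∧ e.symm p.1 * e₁.symm p.2 ∈ e.source}
  have hU : IsOpen U := isOpen_mul_domain e e₁ e
  have he₁1 : e₁.symm (e₁ 1) = 1 := e₁.left_inv (mem_chart_source E 1)
  have hmem : ∀ t ∈ J, (c t, e₁ 1) ∈ U := fun t ht =>
    ⟨e.map_source ht, mem_chart_target E 1, by
      have ht' : η t ∈ e.source := ht
      simpa [he₁1, hc, e.left_inv ht'] using ht'⟩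
  have hode : ∀ t ∈ J, HasCurveDerivAt c (d 1 (c t, e₁ 1) fun _ => (0, γ t)) t := by
    intro t ht
    have h1 := (hd.hasDirDeriv 0 _ (hmem t ht) fun _ => (0, γ t)).comp (tendsto_unitInterval_sub t)
    have h2 := (hη.isTangentAt h t).tendsto e he ht
    have h3 := Tendsto.add h2 h1
    rw [zero_add (d _ _ _)] at h3
    refine h3.congr fun s => ?_
    simp [hd0, chartLine, hc, e.left_inv (show η t ∈ e.source from ht), ← smul_add, ← he₁, he₁1]
  refine isCrCurveOn_top hJ fun m => ?_
  have hcont : ContinuousOn c J := e.continuousOn.comp hη.1.1.continuousOn fun t ht => ht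
  induction m with
  | zero => exact isCrCurveOn_zero.2 hcont
  | succ m ih =>
    refine isCrCurveOn_succ.2 ⟨hcont, _, hode, ?_⟩
    exact hd.isCrCurveOn_comp hU hJ m (j := 1) (c := fun t => (c t, e₁ 1))
      (v := fun _ t => (0, γ t)) hmem (ih.prodMk (isCrCurveOn_const _ _)) fun _ =>
      (isCrCurveOn_const _ _).prodMk ((hγ.of_le le_top).mono (subset_univ J))

end LieGroup

section Evol

variable {𝕜 : Type*} [RCLike 𝕜] {k : ℕ∞}
  {E : Type*} [AddCommGroup E] [Module ℝ E] [Module 𝕜 E] [IsScalarTower ℝ 𝕜 E]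
  [TopologicalSpace E] [IsTopologicalAddGroup E] [ContinuousSMul 𝕜 E]
  {G : Type*} [Group G] [TopologicalSpace G] [ChartedSpace E G]

theorem evol_eq (h : IsLCLieGroup 𝕜 E G) {γ : CkCurve 𝕜 k E} {η : unitInterval → G}
    (hη : IsProductIntegral 𝕜 (k + 1) (CkCurve.curve γ) η) : evol 𝕜 k E G γ = η 1 := by
  have hex : ∃ η : unitInterval → G, IsProductIntegral 𝕜 (k + 1) (CkCurve.curve γ) η := ⟨η, hη⟩
  rw [evol, dif_pos hex]
  exact congrFun (hex.choose_spec.restrictScalars.unique h.restrictScalars hη.restrictScalars) 1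

end Evol

/-! ### Smooth maps between direct sums -/

section Composites

variable {𝕜 : Type*} [RCLike 𝕜] {E F G : Type*} [AddCommGroup E] [Module 𝕜 E]
  [TopologicalSpace E] [AddCommGroup F] [Module 𝕜 F] [TopologicalSpace F]
  [AddCommGroup G] [Module 𝕜 G] [TopologicalSpace G]

theorem IsCrOn.congr {r : ℕ∞} {f g : E → F} {U V : Set E} (h : IsCrOn 𝕜 r f U)
    (hg : ∀ x, g x = f x) (hV : ∀ x, x ∈ V ↔ x ∈ U) : IsCrOn 𝕜 r g V := by
  rwa [funext hg, Set.ext hV]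

theorem IsCrOn.comp_continuousLinearMap {r : ℕ∞} {f : F → G} {U : Set F} (h : IsCrOn 𝕜 r f U)
    (L : E →L[𝕜] F) : IsCrOn 𝕜 r (fun x => f (L x)) (L ⁻¹' U) := by
  obtain ⟨d, h0, h1, h2⟩ := h
  refine ⟨fun j x y => d j (L x) fun i => L (y i), fun x y => h0 _ _, fun j hj x hx y => ?_,
    fun j hj => ?_⟩
  · refine (h1 j hj (L x) hx fun i => L (y i)).congr fun s => ?_
    beta_reduce
    rw [map_add, map_smul]
    rfl
  · refine (h2 j hj).comp (f := fun p : E × (Fin j → E) => (L p.1, fun i => L (p.2 i))) ?_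
      fun p hp => ⟨hp.1, mem_univ _⟩
    exact Continuous.continuousOn (by fun_prop)

theorem IsCrOn.comp_add_sub [ContinuousAdd F] [IsTopologicalAddGroup G] {r : ℕ∞} {f : F → G}
    {U : Set F} (h : IsCrOn 𝕜 r f U) (a : F) (b : G) :
    IsCrOn 𝕜 r (fun x => f (x + a) - b) {x | x + a ∈ U} := by
  obtain ⟨d, h0, h1, h2⟩ := h
  refine ⟨fun j x y => d j (x + a) y - if j = 0 then b else 0, fun x y => ?_,
    fun j hj x hx y => ?_, fun j hj => ?_⟩
  · simp [h0]
  · simp only [Nat.add_eq_zero_iff, one_ne_zero, and_false, if_false, sub_zero]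
    refine (h1 j hj (x + a) hx y).congr fun s => ?_
    rw [sub_sub_sub_cancel_right, add_right_comm]
  · refine ContinuousOn.sub ?_ continuousOn_const
    refine (h2 j hj).comp (f := fun p : F × (Fin j → F) => (p.1 + a, p.2)) ?_
      fun p hp => ⟨hp.1, mem_univ _⟩
    exact Continuous.continuousOn (by fun_prop)

end Composites

namespace FinProd

variable {X : ℕ → Type*} {b : ∀ n, X n} [∀ n, TopologicalSpace (X n)]

theorem continuous_apply (n : ℕ) : Continuous fun x : FinProd X b => x n := by
  classical
  refine continuous_iff_continuousAt.2 fun x U hU => ?_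
  rw [mem_map]
  refine mem_of_superset (box_mem_nhds (x := x) (U := Function.update (fun _ => univ) n U)
    fun m => ?_) fun y hy => by simpa using hy n
  by_cases h : m = n
  · subst h; simpa using hU
  · simp [h]

/-- Componentwise convergence implies convergence in the box topology if only finitely many
components vary. -/
theorem tendsto_nhds_of_cofinite {ι : Type*} {l : Filter ι} {f : ι → FinProd X b}
    {x : FinProd X b} (h : ∀ n, Tendsto (fun i => f i n) l (𝓝 (x n)))
    (hfin : ∀ᶠ n in cofinite, ∀ i, f i n = x n) : Tendsto f l (𝓝 x) := by
  refine (hasBasis_nhds x).tendsto_right_iff.2 fun U hU => ?_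
  have hS : {n | ¬∀ i, f i n = x n}.Finite := hfin
  filter_upwards [(eventually_all_finite hS).2 fun n _ => h n (hU n)] with i hi n
  by_cases hn : ∀ i, f i n = x n
  · rw [hn i]
    exact mem_of_mem_nhds (hU n)
  · exact hi n hn

theorem continuousOn_of_cofinite {Y : Type*} [TopologicalSpace Y] {f : Y → FinProd X b}
    {S : Set Y} (h : ∀ n, ContinuousOn (fun y => f y n) S)
    (hfin : ∀ᶠ n in cofinite, ∀ y y', f y n = f y' n) : ContinuousOn f S := fun y hy =>
  tendsto_nhds_of_cofinite (fun n => h n y hy) (hfin.mono fun _ hn y' => hn y' y)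

instance [∀ n, T2Space (X n)] : T2Space (FinProd X b) :=
  T2Space.of_injective_continuous (f := fun x : FinProd X b => x.val)
    (fun _ _ h => FinProd.ext h) (continuous_pi continuous_apply)

end FinProd

namespace LCDirectSum

variable {E : ℕ → Type*} [∀ n, AddCommGroup (E n)]

@[simp] theorem add_apply (x y : LCDirectSum E) (n : ℕ) : (x + y) n = x n + y n := rfl

@[simp] theorem smul_apply {R : Type*} [Semiring R] [∀ n, Module R (E n)] (r : R)
    (x : LCDirectSum E) (n : ℕ) : (r • x) n = r • x n := rfl

@[simp] theorem sub_apply (x y : LCDirectSum E) (n : ℕ) : (x - y) n = x n - y n := by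
  rw [sub_eq_add_neg, sub_eq_add_neg]
  rfl

variable [∀ n, TopologicalSpace (E n)]

/-- The projection onto the `n`-th summand. -/
def proj (R : Type*) [Semiring R] [∀ n, Module R (E n)] (n : ℕ) : LCDirectSum E →L[R] E n where
  toFun x := x n
  map_add' _ _ := rfl
  map_smul' _ _ := rfl
  cont := FinProd.continuous_apply n

instance [∀ n, Module ℝ (E n)] [∀ n, IsTopologicalAddGroup (E n)]
    [∀ n, LocallyConvexSpace ℝ (E n)] : LocallyConvexSpace ℝ (LCDirectSum E) := by
  refine (locallyConvexSpace_iff_exists_convex_subset_zero ℝ _).2 fun U hU => ?_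
  obtain ⟨V, hV, hVU⟩ := (FinProd.hasBasis_nhds _).mem_iff.1 hU
  choose S hS hSc hSV using fun n =>
    (locallyConvexSpace_iff_exists_convex_subset_zero ℝ (E n)).1 inferInstance (V n) (hV n)
  refine ⟨{y | ∀ n, y n ∈ S n}, FinProd.box_mem_nhds hS, ?_, fun y hy => hVU fun n => hSV n (hy n)⟩
  exact fun x hx y hy r s hr hs hrs n => hSc n (hx n) (hy n) hr hs hrs

variable {F : ℕ → Type*} [∀ n, AddCommGroup (F n)] [∀ n, TopologicalSpace (F n)]

/-- The continuous linear map `((x_n)_n, (y_n)_n) ↦ (x_n, y_n)_n`. -/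
def prodMap (R : Type*) [Semiring R] [∀ n, Module R (E n)] [∀ n, Module R (F n)] :
    LCDirectSum E × LCDirectSum F →L[R] LCDirectSum fun n => E n × F n where
  toFun p := ⟨fun n => (p.1 n, p.2 n), by
    filter_upwards [p.1.finite, p.2.finite] with n h1 h2
    rw [h1, h2]
    rfl⟩
  map_add' _ _ := rfl
  map_smul' _ _ := rfl
  cont := by
    refine continuous_iff_continuousAt.2 fun p => ?_
    refine (FinProd.hasBasis_nhds _).tendsto_right_iff.2 fun U hU => ?_
    have h : ∀ n, ∃ V ∈ 𝓝 (p.1 n), ∃ W ∈ 𝓝 (p.2 n), V ×ˢ W ⊆ U n := fun n => by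
      have := hU n
      rwa [nhds_prod_eq, mem_prod_iff] at this
    choose V hV W hW h using h
    filter_upwards [prod_mem_nhds (FinProd.box_mem_nhds hV) (FinProd.box_mem_nhds hW)]
      with q hq n
    exact h n ⟨hq.1 n, hq.2 n⟩

@[simp] theorem prodMap_apply (R : Type*) [Semiring R] [∀ n, Module R (E n)]
    [∀ n, Module R (F n)] (p : LCDirectSum E × LCDirectSum F) (n : ℕ) :
    prodMap R p n = (p.1 n, p.2 n) := rfl

end LCDirectSum

section DirectSum

variable {𝕜 : Type*} [RCLike 𝕜]
  {X : ℕ → Type*} [∀ n, AddCommGroup (X n)] [∀ n, Module 𝕜 (X n)]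
  {F : ℕ → Type*} [∀ n, AddCommGroup (F n)] [∀ n, Module 𝕜 (F n)] [∀ n, TopologicalSpace (F n)]

theorem hasDirDeriv_directSum {Y : Type*} [AddCommGroup Y] [Module 𝕜 Y] {f : Y → LCDirectSum F}
    {x y : Y} {d : LCDirectSum F} (h : ∀ n, HasDirDeriv 𝕜 (fun z => f z n) x y (d n))
    (hfin : ∀ᶠ n in cofinite, ∀ s : 𝕜, f (x + s • y) n = f x n) : HasDirDeriv 𝕜 f x y d := by
  refine FinProd.tendsto_nhds_of_cofinite (fun n => (h n).congr fun s => ?_) ?_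
  · simp
  · filter_upwards [hfin, d.finite] with n h1 h2 s
    rw [LCDirectSum.smul_apply, LCDirectSum.sub_apply, h1, h2, sub_self, smul_zero]

variable [∀ n, TopologicalSpace (X n)]

/-- A map between direct sums which acts by smooth maps `f_n` on the components is smooth, with
iterated differentials acting componentwise. They take values in the direct sum, because
`d^{j+1} f_n (x, y_1, …, y_{j+1})` vanishes if `y_{j+1} = 0`. -/
theorem IsCrOn.directSum [∀ n, T2Space (F n)] {f : LCDirectSum X → LCDirectSum F}
    {fn : ∀ n, X n → F n} {U : ∀ n, Set (X n)} (hf : ∀ x n, f x n = fn n (x n))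
    (hU : ∀ n, IsOpen (U n)) (h : ∀ n, IsCrOn 𝕜 ⊤ (fn n) (U n)) :
    IsCrOn 𝕜 ⊤ f {x | ∀ n, x n ∈ U n} := by
  classical
  choose d h0 h1 h2 using h
  set D : (j : ℕ) → LCDirectSum X → (Fin j → LCDirectSum X) → LCDirectSum F := fun j x y =>
    if h : ∀ᶠ n in cofinite, d n j (x n) (fun i => y i n) = 0 then
      ⟨fun n => d n j (x n) (fun i => y i n), h⟩ else 0 with hD
  have hD_apply : ∀ j x y, (∀ᶠ n in cofinite, d n j (x n) (fun i => y i n) = 0) → ∀ n,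
      D j x y n = d n j (x n) fun i => y i n := by
    intro j x y h n
    simp only [hD]
    rw [dif_pos h]
  have hfin : ∀ (j : ℕ) (x : LCDirectSum X) (y : Fin j → LCDirectSum X), (∀ n, x n ∈ U n) → ∀ᶠ n in cofinite, d n j (x n) (fun i => y i n) = 0 := by
    intro j x y hx
    cases j with
    | zero =>
      filter_upwards [(f x).finite] with n hn
      rw [h0, ← hf, hn]
    | succ j =>
      filter_upwards [(y (Fin.last j)).finite] with n hn
      have := h1 n j le_top (x n) (hx n) fun i => y i n
      rw [hn] at this
      exact this.unique (hasDirDeriv_zero _ _)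
  refine ⟨D, fun x y => ?_, fun j _ x hx y => ?_, fun j _ => ?_⟩
  · refine FinProd.ext (funext fun n => ?_)
    rw [hD_apply, h0, hf]
    filter_upwards [(f x).finite] with n hn
    rw [h0, ← hf, hn]
  · have hline : ∀ᶠ n in cofinite, ∀ s : 𝕜, (x + s • y (Fin.last j)) n = x n := by
      filter_upwards [(y (Fin.last j)).finite] with n hn s
      rw [LCDirectSum.add_apply, LCDirectSum.smul_apply, hn, smul_zero, add_zero]
    have hfin' : ∀ s : 𝕜, ∀ᶠ n in cofinite,
        d n j ((x + s • y (Fin.last j)) n) (fun i => Fin.init y i n) = 0 := by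
      intro s
      filter_upwards [hline, hfin j x (Fin.init y) hx] with n h3 h4
      rw [h3, h4]
    refine hasDirDeriv_directSum (fun n => ?_) ?_
    · rw [hD_apply _ _ _ (hfin _ x y hx)]
      refine (h1 n j le_top (x n) (hx n) fun i => y i n).congr fun s => ?_
      beta_reduce
      rw [hD_apply _ _ _ (hfin' s), hD_apply _ _ _ (hfin _ x _ hx)]
      rfl
    · filter_upwards [hline] with n hn s
      rw [hD_apply _ _ _ (hfin' s), hD_apply _ _ _ (hfin _ x _ hx), hn]
  · rintro ⟨x, y⟩ ⟨hx, -⟩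
    refine ContinuousAt.continuousWithinAt ?_
    refine (FinProd.hasBasis_nhds _).tendsto_right_iff.2 fun W hW => ?_
    have key : ∀ n, ∃ V ∈ 𝓝 (x n), ∃ B : Fin j → Set (X n), (∀ i, B i ∈ 𝓝 (y i n)) ∧
        ∀ z ∈ V, ∀ w : Fin j → X n, (∀ i, w i ∈ B i) → d n j z w ∈ W n := by
      intro n
      have hc := (h2 n j le_top).continuousAt (((hU n).prod isOpen_univ).mem_nhds
        (show (x n, fun i => y i n) ∈ U n ×ˢ univ from ⟨hx n, mem_univ _⟩))
      have hWn := hW n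
      rw [hD_apply _ _ _ (hfin _ x y hx)] at hWn
      have := hc hWn
      rw [nhds_prod_eq, nhds_pi] at this
      obtain ⟨V, hV, B', hB', hVB⟩ := mem_prod_iff.1 this
      obtain ⟨I, -, B, hB, hBB⟩ := mem_pi.1 hB'
      exact ⟨V, hV, B, hB, fun z hz w hw => hVB (mk_mem_prod hz (hBB fun i _ => hw i))⟩
    choose V hV B hB hVB using key
    have hy : ∀ᶠ p : LCDirectSum X × (Fin j → LCDirectSum X) in 𝓝 (x, y), ∀ i n,
        p.2 i n ∈ B n i := eventually_all.2 fun i => by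
      have hc : ContinuousAt (fun p : LCDirectSum X × (Fin j → LCDirectSum X) => p.2 i) (x, y) := by
        fun_prop
      exact hc (FinProd.box_mem_nhds (x := y i) fun n => hB n i)
    have hx' : ∀ᶠ p : LCDirectSum X × (Fin j → LCDirectSum X) in 𝓝 (x, y), ∀ n,
        p.1 n ∈ V n ∩ U n := by
      have hc : ContinuousAt (fun p : LCDirectSum X × (Fin j → LCDirectSum X) => p.1) (x, y) :=
        continuousAt_fst
      exact hc (FinProd.box_mem_nhds (x := x) fun n => inter_mem (hV n) ((hU n).mem_nhds (hx n)))
    filter_upwards [hy, hx'] with p hp1 hp2 n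
    rw [hD_apply _ _ _ (hfin _ p.1 p.2 fun n => (hp2 n).2)]
    exact hVB n _ (hp2 n).1 _ fun i => hp1 i n

end DirectSum

/-! ### The Lie group structure on the weak direct product -/

section CenteredCharts

variable {E : Type*} [AddCommGroup E] [TopologicalSpace E] [IsTopologicalAddGroup E]
  {M : Type*} [TopologicalSpace M] [ChartedSpace E M]

theorem centeredChartAt_apply (x y : M) :
    centeredChartAt E x y = chartAt E x y - chartAt E x x := rfl

theorem centeredChartAt_symm_apply (x : M) (v : E) :
    (centeredChartAt E x).symm v = (chartAt E x).symm (v + chartAt E x x) := rfl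

theorem mem_centeredChartAt_target {x : M} {v : E} :
    v ∈ (centeredChartAt E x).target ↔ v + chartAt E x x ∈ (chartAt E x).target := by
  simp [centeredChartAt]

theorem centeredChartAt_self (x : M) : centeredChartAt E x x = 0 := by
  rw [centeredChartAt_apply, sub_self]

theorem centeredChartAt_symm_zero (x : M) : (centeredChartAt E x).symm 0 = x := by
  rw [centeredChartAt_symm_apply, zero_add, (chartAt E x).left_inv (mem_chart_source E x)]

end CenteredCharts

section SmoothCenteredCharts

variable {𝕜 : Type*} [RCLike 𝕜] {E : Type*} [AddCommGroup E] [Module ℝ E] [Module 𝕜 E]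
  [TopologicalSpace E] [IsTopologicalAddGroup E]
  {G : Type*} [Group G] [TopologicalSpace G] [ChartedSpace E G]

namespace IsLCLieGroup

theorem smooth_transition_centered (h : IsLCLieGroup 𝕜 E G) (x x' : G) :
    IsCrOn 𝕜 ⊤ (fun v => centeredChartAt E x' ((centeredChartAt E x).symm v))
      {v | v ∈ (centeredChartAt E x).target ∧
        (centeredChartAt E x).symm v ∈ (centeredChartAt E x').source} := by
  have := (h.smooth_transition _ (chart_mem_atlas E x) _ (chart_mem_atlas E x')).comp_add_sub
    (chartAt E x x) (chartAt E x' x')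
  exact this.congr (fun _ => rfl) fun v => and_congr_left' mem_centeredChartAt_target

theorem smooth_mul_centered (h : IsLCLieGroup 𝕜 E G) (x x' x'' : G) :
    IsCrOn 𝕜 ⊤ (fun p : E × E =>
        centeredChartAt E x'' ((centeredChartAt E x).symm p.1 * (centeredChartAt E x').symm p.2))
      {p | p.1 ∈ (centeredChartAt E x).target ∧ p.2 ∈ (centeredChartAt E x').target ∧
        (centeredChartAt E x).symm p.1 * (centeredChartAt E x').symm p.2 ∈
          (centeredChartAt E x'').source} := by
  have := (h.smooth_mul _ (chart_mem_atlas E x) _ (chart_mem_atlas E x') _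
    (chart_mem_atlas E x'')).comp_add_sub (chartAt E x x, chartAt E x' x') (chartAt E x'' x'')
  exact this.congr (fun _ => rfl) fun p =>
    and_congr mem_centeredChartAt_target (and_congr_left' mem_centeredChartAt_target)

theorem smooth_inv_centered (h : IsLCLieGroup 𝕜 E G) (x x' : G) :
    IsCrOn 𝕜 ⊤ (fun v => centeredChartAt E x' ((centeredChartAt E x).symm v)⁻¹)
      {v | v ∈ (centeredChartAt E x).target ∧
        ((centeredChartAt E x).symm v)⁻¹ ∈ (centeredChartAt E x').source} := by
  have := (h.smooth_inv _ (chart_mem_atlas E x) _ (chart_mem_atlas E x')).comp_add_sub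
    (chartAt E x x) (chartAt E x' x')
  exact this.congr (fun _ => rfl) fun v => and_congr_left' mem_centeredChartAt_target

end IsLCLieGroup

end SmoothCenteredCharts

section WeakProd

variable {H : ℕ → Type*} [∀ n, Group (H n)]

namespace WeakProd

@[simp] theorem one_apply (n : ℕ) : (1 : WeakProd H) n = 1 := rfl

@[simp] theorem mul_apply (x y : WeakProd H) (n : ℕ) : (x * y) n = x n * y n := rfl

@[simp] theorem inv_apply (x : WeakProd H) (n : ℕ) : x⁻¹ n = (x n)⁻¹ := rfl

instance [∀ n, TopologicalSpace (H n)] [∀ n, IsTopologicalGroup (H n)] :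
    IsTopologicalGroup (WeakProd H) where
  continuous_mul := by
    refine continuous_iff_continuousAt.2 fun ⟨x, y⟩ => ?_
    refine (FinProd.hasBasis_nhds _).tendsto_right_iff.2 fun U hU => ?_
    have h : ∀ n, ∃ V ∈ 𝓝 (x n), ∃ W ∈ 𝓝 (y n), ∀ v ∈ V, ∀ w ∈ W, v * w ∈ U n := by
      intro n
      have := (continuous_mul.tendsto (x n, y n)) (hU n)
      rw [mem_map, nhds_prod_eq, mem_prod_iff] at this
      obtain ⟨V, hV, W, hW, h⟩ := this
      exact ⟨V, hV, W, hW, fun v hv w hw => h (mk_mem_prod hv hw)⟩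
    choose V hV W hW h using h
    filter_upwards [prod_mem_nhds (FinProd.box_mem_nhds hV) (FinProd.box_mem_nhds hW)]
      with p hp n
    exact h n _ (hp.1 n) _ (hp.2 n)
  continuous_inv := continuous_iff_continuousAt.2 fun x =>
    FinProd.continuousAt_map (f := fun n => (fun v : H n => v⁻¹))
      (Eventually.of_forall fun _ => inv_one) fun _ => continuous_inv.continuousAt

variable {E : ℕ → Type*} [∀ n, AddCommGroup (E n)] [∀ n, TopologicalSpace (E n)]
  [∀ n, IsTopologicalAddGroup (E n)] [∀ n, TopologicalSpace (H n)]
  [∀ n, ChartedSpace (E n) (H n)]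

/-- The charts of the weak direct product act by centered charts of the factors. -/
theorem exists_of_mem_atlas {e : OpenPartialHomeomorph (WeakProd H) (LCDirectSum E)}
    (he : e ∈ atlas (LCDirectSum E) (WeakProd H)) : ∃ x : WeakProd H,
      (∀ y n, e y n = centeredChartAt (E n) (x n) (y n)) ∧
      (∀ v n, e.symm v n = (centeredChartAt (E n) (x n)).symm (v n)) ∧
      e.source = {y | ∀ n, y n ∈ (centeredChartAt (E n) (x n)).source} ∧
      e.target = {v | ∀ n, v n ∈ (centeredChartAt (E n) (x n)).target} := by
  obtain ⟨x, rfl⟩ := he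
  exact ⟨x, fun _ _ => rfl, fun _ _ => rfl, rfl, rfl⟩

theorem chartAt_apply (x y : WeakProd H) (n : ℕ) :
    chartAt (LCDirectSum E) x y n = centeredChartAt (E n) (x n) (y n) := rfl

theorem chartAt_symm_apply (x : WeakProd H) (v : LCDirectSum E) (n : ℕ) :
    (chartAt (LCDirectSum E) x).symm v n = (centeredChartAt (E n) (x n)).symm (v n) := rfl

variable {𝕜 : Type*} [RCLike 𝕜] [∀ n, Module ℝ (E n)] [∀ n, Module 𝕜 (E n)]

theorem isLCLieGroup (hLie : ∀ n, IsLCLieGroup 𝕜 (E n) (H n)) :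
    IsLCLieGroup 𝕜 (LCDirectSum E) (WeakProd H) := by
  have := fun n => (hLie n).model_continuousSMul
  have := fun n => (hLie n).model_locallyConvex
  have := fun n => (hLie n).model_t2
  have := fun n => (hLie n).t2
  have := fun n => (hLie n).isTopologicalGroup
  refine ⟨inferInstance, inferInstance, inferInstance, inferInstance, inferInstance, ?_,
    inferInstance, ?_, ?_⟩
  · intro e he e' he'
    obtain ⟨x, -, hs, -, ht⟩ := exists_of_mem_atlas he
    obtain ⟨x', ha', -, hso', -⟩ := exists_of_mem_atlas he'
    have := IsCrOn.directSum (f := fun v => e' (e.symm v)) (fun v n => by rw [ha', hs])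
      (fun n => (centeredChartAt (E n) (x n)).isOpen_inter_preimage_symm
        (centeredChartAt (E n) (x' n)).open_source)
      fun n => (hLie n).smooth_transition_centered (x n) (x' n)
    refine this.congr (fun _ => rfl) fun v => ?_
    simp [ht, hso', hs, forall_and]
  · intro e he e' he' e'' he''
    obtain ⟨x, -, hs, -, ht⟩ := exists_of_mem_atlas he
    obtain ⟨x', -, hs', -, ht'⟩ := exists_of_mem_atlas he'
    obtain ⟨x'', ha'', -, hso'', -⟩ := exists_of_mem_atlas he''
    -- the product is a composite of the regrouping `prodMap` and a map acting componentwise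
    set f : LCDirectSum (fun n => E n × E n) → LCDirectSum E := fun z =>
      e'' (e.symm (FinProd.map (c := fun n => (0 : E n)) (fun n => Prod.fst) (by simp) z) *
        e'.symm (FinProd.map (c := fun n => (0 : E n)) (fun n => Prod.snd) (by simp) z)) with hf
    have := (IsCrOn.directSum (𝕜 := 𝕜) (f := f) (fun z n => by rw [hf, ha'', mul_apply, hs, hs']; rfl)
      (fun n => isOpen_mul_domain (centeredChartAt (E n) (x n)) (centeredChartAt (E n) (x' n))
        (centeredChartAt (E n) (x'' n)))
      fun n => (hLie n).smooth_mul_centered (x n) (x' n) (x'' n)).comp_continuousLinearMap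
        (LCDirectSum.prodMap 𝕜)
    refine this.congr (fun _ => rfl) fun p => ?_
    simp [ht, ht', hso'', hs, hs', forall_and]
  · intro e he e' he'
    obtain ⟨x, -, hs, -, ht⟩ := exists_of_mem_atlas he
    obtain ⟨x', ha', -, hso', -⟩ := exists_of_mem_atlas he'
    have := IsCrOn.directSum (f := fun v => e' (e.symm v)⁻¹)
      (fun v n => by rw [ha', inv_apply, hs])
      (fun n => isOpen_inv_domain (centeredChartAt (E n) (x n)) (centeredChartAt (E n) (x' n)))
      fun n => (hLie n).smooth_inv_centered (x n) (x' n)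
    refine this.congr (fun _ => rfl) fun v => ?_
    simp [ht, hso', hs, forall_and]

end WeakProd

end WeakProd

/-! ### Curves in direct sums -/

/-- A compact set in the box topology involves only finitely many components. -/
theorem FinProd.eventually_forall_eq_of_isCompact {X : ℕ → Type*} {b : ∀ n, X n}
    [∀ n, TopologicalSpace (X n)] [∀ n, T1Space (X n)] {K : Set (FinProd X b)}
    (hK : IsCompact K) : ∀ᶠ n in cofinite, ∀ x ∈ K, x n = b n := by
  -- a neighbourhood of the base point which excludes the `n`-th component of a point of `K`
  have h : ∀ n, ∃ U : Set (X n), IsOpen U ∧ b n ∈ U ∧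
      ((∀ x ∈ K, x n ∈ U) → ∀ x ∈ K, x n = b n) := by
    intro n
    by_cases hn : ∀ x ∈ K, x n = b n
    · exact ⟨univ, isOpen_univ, mem_univ _, fun _ => hn⟩
    · push Not at hn
      obtain ⟨x, hx, hxb⟩ := hn
      exact ⟨{x n}ᶜ, isOpen_compl_singleton, fun h => hxb h.symm, fun h => absurd rfl (h x hx)⟩
  choose U hU hb hUK using h
  obtain ⟨m, hm⟩ := hK.elim_directed_cover
    (fun m : ℕ => {y : FinProd X b | ∀ n, y n ∈ {z : X n | m ≤ n → z ∈ U n}})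
    (fun m => isOpen_box fun n => by
      by_cases h : m ≤ n
      · simpa [h] using hU n
      · simp [h])
    (fun x _ => by
      obtain ⟨m, hm⟩ := eventually_atTop.1 (Nat.cofinite_eq_atTop ▸ x.finite)
      exact mem_iUnion.2 ⟨m, fun n hn => by rw [hm n hn]; exact hb n⟩)
    (directed_of_isDirected_le fun m m' hmm x hx n hn => hx n (hmm.trans hn))
  rw [Nat.cofinite_eq_atTop]
  filter_upwards [eventually_ge_atTop m] with n hn
  exact hUK n fun x hx => hm hx n hn

section DirectSumCurves

variable {E : ℕ → Type*} [∀ n, AddCommGroup (E n)] [∀ n, Module ℝ (E n)]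
  [∀ n, TopologicalSpace (E n)]

theorem hasCurveDerivAt_directSum {c : unitInterval → LCDirectSum E} {v : LCDirectSum E}
    {t : unitInterval} (h : ∀ n, HasCurveDerivAt (fun s => c s n) (v n) t)
    (hfin : ∀ᶠ n in cofinite, ∀ s, c s n = c t n) : HasCurveDerivAt c v t := by
  refine FinProd.tendsto_nhds_of_cofinite (fun n => (h n).congr fun s => ?_) ?_
  · simp
  · filter_upwards [hfin, v.finite] with n h1 h2 s
    rw [LCDirectSum.smul_apply, LCDirectSum.sub_apply, h1, h2, sub_self, smul_zero]

theorem IsCrCurveOn.directSum {r : ℕ∞} {c : unitInterval → LCDirectSum E}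
    {J : Set unitInterval} (h : ∀ n, IsCrCurveOn r (fun t => c t n) J)
    (hfin : ∀ᶠ n in cofinite, ∀ s t, c s n = c t n) : IsCrCurveOn r c J := by
  have h' : ∀ n, ∃ D : ℕ → unitInterval → E n, (D 0 = fun t => c t n) ∧
      (∀ j : ℕ, ((j + 1 : ℕ) : ℕ∞) ≤ r → ∀ t ∈ J, HasCurveDerivAt (D j) (D (j + 1) t) t) ∧
      (∀ j : ℕ, (j : ℕ∞) ≤ r → ContinuousOn (D j) J) ∧
      ((∀ s t, c s n = c t n) → ∀ j t, D (j + 1) t = 0) := by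
    intro n
    by_cases hn : ∀ s t, c s n = c t n
    · rw [show (fun t => c t n) = fun _ => c 0 n from funext fun t => hn t 0]
      refine ⟨fun j => Nat.casesOn j (fun _ => c 0 n) fun _ _ => 0, rfl, fun j _ t _ => ?_,
        fun j _ => ?_, fun _ _ _ => rfl⟩
      · cases j <;> exact hasCurveDerivAt_const _ _
      · cases j <;> exact continuousOn_const
    · obtain ⟨D, h0, h1, h2⟩ := h n
      exact ⟨D, h0, h1, h2, fun hn' => absurd hn' hn⟩
  choose D h0 h1 h2 h3 using h'
  obtain ⟨D', hD'0, hD'⟩ : ∃ D' : ℕ → unitInterval → LCDirectSum E,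
      D' 0 = c ∧ ∀ j t n, D' j t n = D n j t := by
    refine ⟨fun j => Nat.casesOn j c fun i t =>
      ⟨fun n => D n (i + 1) t, hfin.mono fun n hn => h3 n hn i t⟩, rfl, fun j t n => ?_⟩
    cases j with
    | zero => rw [h0]; rfl
    | succ j => rfl
  have hconst : ∀ j, ∀ᶠ n in cofinite, ∀ s t, D' j s n = D' j t n := by
    intro j
    filter_upwards [hfin] with n hn s t
    cases j with
    | zero => rw [hD'0, hn s t]
    | succ j => rw [hD', hD', h3 n hn, h3 n hn]
  refine ⟨D', hD'0, fun j hj t ht => hasCurveDerivAt_directSum (fun n => ?_) ?_,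
    fun j hj => FinProd.continuousOn_of_cofinite (fun n => ?_) (hconst j)⟩
  · simpa only [hD'] using h1 n j hj t ht
  · exact (hconst j).mono fun n hn s => hn s t
  · simpa only [hD'] using h2 n j hj

end DirectSumCurves

/-! ### The spaces of `C^k`-curves -/

theorem ContinuousMap.exists_of_mem_nhds_zero {X E : Type*} [TopologicalSpace X]
    [TopologicalSpace E] [AddCommGroup E] [IsTopologicalAddGroup E] {S : Set C(X, E)}
    (hS : S ∈ 𝓝 (0 : C(X, E))) : ∃ W ∈ 𝓝 (0 : E), {f : C(X, E) | ∀ x, f x ∈ W} ⊆ S := by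
  have hmono : Monotone fun W : Set E => {f : C(X, E) | ∀ x, f x ∈ W} :=
    fun W W' h f hf x => h (hf x)
  have : Tendsto id ((𝓝 (0 : E)).lift' fun W => {f : C(X, E) | ∀ x, f x ∈ W})
      (𝓝 (0 : C(X, E))) := by
    refine ContinuousMap.tendsto_nhds_compactOpen.2 fun K _ U hU h0 => ?_
    rcases K.eq_empty_or_nonempty with rfl | ⟨x, hx⟩
    · exact Eventually.of_forall fun f => mapsTo_empty _ _
    · exact mem_of_superset (mem_lift' (hU.mem_nhds (h0 hx))) fun f hf x _ => hf x
  exact (mem_lift'_sets hmono).1 (this hS)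

namespace CkCurve

section Basic

variable {𝕜 : Type*} [RCLike 𝕜] {k : ℕ∞} {E : Type*} [AddCommGroup E] [Module ℝ E] [Module 𝕜 E]
  [IsScalarTower ℝ 𝕜 E] [TopologicalSpace E] [IsTopologicalAddGroup E] [ContinuousSMul 𝕜 E]

theorem isCrCurveOn_curve (γ : CkCurve 𝕜 (⊤ : ℕ∞) E) : IsCrCurveOn ⊤ (curve γ) univ :=
  ⟨fun j => γ.1 ⟨j, le_top⟩, rfl, fun j hj t _ => γ.2 j hj t,
    fun j _ => (γ.1 ⟨j, le_top⟩).continuous.continuousOn⟩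

theorem curve_zero : curve (0 : CkCurve 𝕜 k E) = fun _ => 0 := rfl

theorem continuous_curve (γ : CkCurve 𝕜 k E) : Continuous (curve γ) := ContinuousMap.continuous _

theorem eq_zero_of_curve_eq_zero [T2Space E] {γ : CkCurve 𝕜 k E} (h : ∀ t, curve γ t = 0) :
    γ = 0 := by
  have key : ∀ (j : ℕ) (hj : (j : ℕ∞) ≤ k) (t : unitInterval), γ.1 ⟨j, hj⟩ t = 0 := by
    intro j
    induction j with
    | zero => exact fun _ t => h t
    | succ j ih =>
      intro hj t
      have h1 := γ.2 j hj t
      rw [show (γ.1 ⟨j, _⟩ : unitInterval → E) = fun _ => 0 from funext fun s => ih _ s] at h1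
      exact h1.unique (hasCurveDerivAt_const 0 t)
  exact Subtype.ext (funext fun j => ContinuousMap.ext fun t => key j.1 j.2 t)

/-- The inclusion `C^{k'}([0,1], E) → C^k([0,1], E)` for `k ≤ k'`. -/
def restrict {k' : ℕ∞} (h : k ≤ k') : CkCurve 𝕜 k' E →L[𝕜] CkCurve 𝕜 k E where
  toFun γ := ⟨fun j => γ.1 ⟨j.1, j.2.trans h⟩, fun j hj t => γ.2 j (hj.trans h) t⟩
  map_add' _ _ := rfl
  map_smul' _ _ := rfl
  cont := (continuous_pi fun j => (continuous_apply (⟨j.1, j.2.trans h⟩ :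
    {j : ℕ // (j : ℕ∞) ≤ k'})).comp continuous_subtype_val).subtype_mk _

/-- For finite `k`, the `C^k`-topology is uniform convergence of finitely many derivatives. -/
theorem mem_nhds_zero {k : ℕ} {S : Set (CkCurve 𝕜 (k : ℕ∞) E)} :
    S ∈ 𝓝 0 ↔ ∃ W ∈ 𝓝 (0 : E), {γ : CkCurve 𝕜 (k : ℕ∞) E | ∀ j t, γ.1 j t ∈ W} ⊆ S := by
  have hfin : Finite {j : ℕ // (j : ℕ∞) ≤ (k : ℕ∞)} := by
    simp only [Nat.cast_le]
    exact (inferInstance : Finite (Iic k))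
  constructor
  · intro hS
    rw [nhds_subtype, mem_comap] at hS
    obtain ⟨T, hT, hTS⟩ := hS
    rw [nhds_pi] at hT
    obtain ⟨I, -, T', hT', hTT⟩ := mem_pi.1 hT
    choose W hW hWT using fun j => ContinuousMap.exists_of_mem_nhds_zero (hT' j)
    exact ⟨⋂ j, W j, iInter_mem.2 hW, fun γ hγ => hTS (hTT fun j _ =>
      hWT j fun t => mem_iInter.1 (hγ j t) j)⟩
  · rintro ⟨W, hW, hWS⟩
    refine mem_of_superset ?_ hWS
    refine eventually_all.2 fun j => ?_
    have hc : ContinuousAt (fun γ : CkCurve 𝕜 (k : ℕ∞) E => γ.1 j) 0 :=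
      ((continuous_apply j).comp continuous_subtype_val).continuousAt
    have ho : IsOpen {f : C(unitInterval, E) | MapsTo f univ (interior W)} :=
      ContinuousMap.isOpen_setOfPred_mapsTo isCompact_univ isOpen_interior
    filter_upwards [hc (ho.mem_nhds fun t _ => mem_interior_iff_mem_nhds.2 hW)] with γ hγ t
    exact interior_subset (hγ (mem_univ t))

end Basic

section DirectSum

variable {𝕜 : Type*} [RCLike 𝕜] {E : ℕ → Type*} [∀ n, AddCommGroup (E n)] [∀ n, Module ℝ (E n)]
  [∀ n, Module 𝕜 (E n)] [∀ n, IsScalarTower ℝ 𝕜 (E n)] [∀ n, TopologicalSpace (E n)]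
  [∀ n, IsTopologicalAddGroup (E n)] [∀ n, ContinuousSMul 𝕜 (E n)]

/-- The `n`-th component of a curve in `⨁_n E_n`. -/
def component {k : ℕ∞} (γ : CkCurve 𝕜 k (LCDirectSum E)) (n : ℕ) : CkCurve 𝕜 k (E n) :=
  ⟨fun j => ⟨fun t => γ.1 j t n, (FinProd.continuous_apply n).comp (γ.1 j).continuous⟩,
    fun j hj t => (γ.2 j hj t).map (LCDirectSum.proj ℝ n)⟩

theorem curve_component {k : ℕ∞} (γ : CkCurve 𝕜 k (LCDirectSum E)) (n : ℕ) (t : unitInterval) :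
    curve (component γ n) t = curve γ t n := rfl

theorem eventually_component_eq_zero [∀ n, T2Space (E n)] {k : ℕ∞}
    (γ : CkCurve 𝕜 k (LCDirectSum E)) : ∀ᶠ n in cofinite, component γ n = 0 := by
  filter_upwards [FinProd.eventually_forall_eq_of_isCompact
    (isCompact_range (continuous_curve γ))] with n hn
  exact eq_zero_of_curve_eq_zero fun t => hn _ (mem_range_self t)

/-- The curve in `⨁_n E_n` with given components, almost all of which vanish. -/
def ofComponents {k : ℕ∞} (γ : LCDirectSum fun n => CkCurve 𝕜 k (E n)) :
    CkCurve 𝕜 k (LCDirectSum E) :=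
  have hfin : ∀ᶠ n in cofinite, ∀ j t, (γ n).1 j t = 0 := by
    filter_upwards [γ.finite] with n hn j t
    rw [hn]
    rfl
  ⟨fun j => ⟨fun t => ⟨fun n => (γ n).1 j t, hfin.mono fun n hn => hn j t⟩,
      continuous_iff_continuousAt.2 fun t => FinProd.tendsto_nhds_of_cofinite
        (fun n => ((γ n).1 j).continuous.continuousAt)
        (hfin.mono fun n hn s => (hn j s).trans (hn j t).symm)⟩,
    fun j hj t => hasCurveDerivAt_directSum (fun n => (γ n).2 j hj t)
      (hfin.mono fun n hn s => (hn _ s).trans (hn _ t).symm)⟩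

/-- The isomorphism `C^k([0,1], ⨁_n E_n) ≅ ⨁_n C^k([0,1], E_n)` for finite `k`. -/
def directSumEquiv [∀ n, T2Space (E n)] (k : ℕ) :
    CkCurve 𝕜 (k : ℕ∞) (LCDirectSum E) ≃L[𝕜] LCDirectSum fun n => CkCurve 𝕜 (k : ℕ∞) (E n) where
  toFun γ := ⟨component γ, eventually_component_eq_zero γ⟩
  invFun := ofComponents
  map_add' _ _ := rfl
  map_smul' _ _ := rfl
  left_inv _ := rfl
  right_inv _ := rfl
  continuous_toFun := by
    refine continuous_of_continuousAt_zero (AddMonoidHom.mk'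
      (fun γ : CkCurve 𝕜 (k : ℕ∞) (LCDirectSum E) =>
        (⟨component γ, eventually_component_eq_zero γ⟩ :
          LCDirectSum fun n => CkCurve 𝕜 (k : ℕ∞) (E n))) fun _ _ => rfl) ?_
    refine (FinProd.hasBasis_nhds _).tendsto_right_iff.2 fun U hU => ?_
    choose W hW hWU using fun n => mem_nhds_zero.1 (hU n)
    refine mem_nhds_zero.2 ⟨_, FinProd.box_mem_nhds (x := (0 : LCDirectSum E)) hW, ?_⟩
    exact fun γ hγ n => hWU n fun j t => hγ j t n
  continuous_invFun := by
    refine continuous_of_continuousAt_zero (AddMonoidHom.mk'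
      (fun γ : LCDirectSum fun n => CkCurve 𝕜 (k : ℕ∞) (E n) => ofComponents γ)
      fun _ _ => rfl) ?_
    intro S hS
    obtain ⟨W, hW, hWS⟩ := mem_nhds_zero.1 hS
    obtain ⟨V, hV, hVW⟩ := (FinProd.hasBasis_nhds _).mem_iff.1 hW
    rw [mem_map]
    refine mem_of_superset (FinProd.box_mem_nhds
      (x := (0 : LCDirectSum fun n => CkCurve 𝕜 (k : ℕ∞) (E n)))
      fun n => mem_nhds_zero.2 ⟨V n, hV n, Subset.rfl⟩) ?_
    exact fun γ hγ => hWS fun j t => hVW fun n => hγ n j t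

end DirectSum

end CkCurve

/-! ### Product integrals in the weak direct product -/

section Trivial

variable {𝕜 : Type*} [RCLike 𝕜] {E : Type*} [AddCommGroup E] [Module ℝ E] [Module 𝕜 E]
  [TopologicalSpace E] {G : Type*} [Group G] [TopologicalSpace G] [ChartedSpace E G]

theorem isProductIntegral_zero_one (r : ℕ∞) :
    IsProductIntegral 𝕜 r (fun _ => (0 : E)) (fun _ => (1 : G)) :=
  ⟨⟨continuous_const, fun _ _ => isCrCurveOn_const _ _⟩, rfl, fun _ =>
    ⟨0, hasDirDeriv_zero _ _, hasCurveDerivAt_const _ _⟩⟩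

end Trivial

namespace WeakProd

variable {𝕜 : Type*} [RCLike 𝕜] {E : ℕ → Type*} [∀ n, AddCommGroup (E n)]
  [∀ n, Module ℝ (E n)] [∀ n, Module 𝕜 (E n)] [∀ n, TopologicalSpace (E n)]
  [∀ n, IsTopologicalAddGroup (E n)]
  {H : ℕ → Type*} [∀ n, Group (H n)] [∀ n, TopologicalSpace (H n)]
  [∀ n, ChartedSpace (E n) (H n)]

/-- Families of product integrals, almost all of them constant, are product integrals in the weak
direct product. -/
theorem isProductIntegral [∀ n, T2Space (E n)] {r : ℕ∞} {γ : unitInterval → LCDirectSum E}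
    {η : unitInterval → WeakProd H}
    (h : ∀ n, IsProductIntegral 𝕜 r (fun t => γ t n) (fun t => η t n))
    (hγ : ∀ᶠ n in cofinite, ∀ t, γ t n = 0) (hη : ∀ᶠ n in cofinite, ∀ t, η t n = 1) :
    IsProductIntegral 𝕜 r γ η := by
  have hconst : ∀ᶠ n in cofinite, ∀ s t, η s n = η t n :=
    hη.mono fun n hn s t => (hn s).trans (hn t).symm
  refine ⟨⟨continuous_iff_continuousAt.2 fun t => FinProd.tendsto_nhds_of_cofinite
    (fun n => (h n).1.1.continuousAt) (hconst.mono fun n hn s => hn s t), fun e he => ?_⟩,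
    FinProd.ext (funext fun n => (h n).2.1), fun t => ?_⟩
  · obtain ⟨x, ha, -, hso, -⟩ := exists_of_mem_atlas he
    refine IsCrCurveOn.directSum (fun n => ?_) (hconst.mono fun n hn s t => by rw [ha, ha, hn s t])
    have := (((h n).1.2 _ (chart_mem_atlas (E n) (x n))).add
      (isCrCurveOn_const r (-chartAt (E n) (x n) (x n)))).mono
      (J' := η ⁻¹' e.source) fun t ht => by
        rw [mem_preimage, hso] at ht
        exact ht n
    simpa only [ha, centeredChartAt_apply, sub_eq_add_neg] using this
  · choose w hw hw' using fun n => (h n).2.2 t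
    have hw0 : ∀ᶠ n in cofinite, w n = 0 := by
      filter_upwards [hη] with n hn
      have h1 := hw' n
      simp only [HasVelocityAt, hn] at h1
      exact h1.unique (hasCurveDerivAt_const _ _)
    refine ⟨⟨w, hw0⟩, hasDirDeriv_directSum (fun n => ?_) ?_,
      hasCurveDerivAt_directSum (fun n => ?_) ?_⟩
    · refine (hw n).congr fun s => ?_
      simp [chartAt_apply, chartAt_symm_apply, centeredChartAt_apply, centeredChartAt_symm_apply,
        add_comm]
    · filter_upwards [hγ] with n hn s
      simp [chartAt_apply, chartAt_symm_apply, hn, centeredChartAt_self,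
        centeredChartAt_symm_zero]
    · refine (hw' n).congr fun s => ?_
      simp [chartAt_apply, centeredChartAt_apply]
    · filter_upwards [hconst] with n hn s
      rw [chartAt_apply, chartAt_apply, hn s t]

end WeakProd

/-! ### Smooth maps into the weak direct product -/

section SmoothInto

variable {𝕜 : Type*} [RCLike 𝕜]

theorem IsSmoothInto.comp_continuousLinearMap {X Y E : Type*} [AddCommGroup X] [Module 𝕜 X]
    [TopologicalSpace X] [AddCommGroup Y] [Module 𝕜 Y] [TopologicalSpace Y]
    [AddCommGroup E] [Module 𝕜 E] [TopologicalSpace E]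
    {M : Type*} [TopologicalSpace M] [ChartedSpace E M] {f : Y → M}
    (hf : IsSmoothInto 𝕜 E f) (L : X →L[𝕜] Y) : IsSmoothInto 𝕜 E (f ∘ L) :=
  ⟨hf.1.comp L.continuous, fun e he => (hf.2 e he).comp_continuousLinearMap L⟩

theorem IsSmoothInto.weakProd {X E : ℕ → Type*} [∀ n, AddCommGroup (X n)] [∀ n, Module 𝕜 (X n)]
    [∀ n, TopologicalSpace (X n)] [∀ n, ContinuousAdd (X n)]
    [∀ n, AddCommGroup (E n)] [∀ n, Module 𝕜 (E n)]
    [∀ n, TopologicalSpace (E n)] [∀ n, IsTopologicalAddGroup (E n)] [∀ n, T2Space (E n)]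
    {H : ℕ → Type*} [∀ n, Group (H n)] [∀ n, TopologicalSpace (H n)]
    [∀ n, ChartedSpace (E n) (H n)] {f : ∀ n, X n → H n}
    (hf : ∀ n, IsSmoothInto 𝕜 (E n) (f n)) (h1 : ∀ n, f n 0 = 1) :
    IsSmoothInto 𝕜 (LCDirectSum E) (FinProd.map (b := fun n => (0 : X n))
      (c := fun n => (1 : H n)) f (Eventually.of_forall h1)) := by
  refine ⟨continuous_iff_continuousAt.2 fun x =>
    FinProd.continuousAt_map _ fun n => (hf n).1.continuousAt, fun e he => ?_⟩
  obtain ⟨x, ha, -, hso, -⟩ := WeakProd.exists_of_mem_atlas he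
  have hn : ∀ n, IsCrOn 𝕜 ⊤ (fun v => centeredChartAt (E n) (x n) (f n v))
      (f n ⁻¹' (centeredChartAt (E n) (x n)).source) := fun n =>
    (((hf n).2 _ (chart_mem_atlas (E n) (x n))).comp_add_sub 0
      (chartAt (E n) (x n) (x n))).congr (fun v => by rw [add_zero]; rfl)
        fun v => by rw [mem_ofPred, add_zero]; rfl
  refine (IsCrOn.directSum (fun v n => ha _ n)
    (fun n => (centeredChartAt (E n) (x n)).open_source.preimage (hf n).1) hn).congr
    (fun _ => rfl) fun v => ?_
  rw [mem_preimage, hso]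
  rfl

end SmoothInto

/-! ### Regularity of the weak direct product -/

theorem evol_zero {𝕜 : Type*} [RCLike 𝕜] {k : ℕ∞} {E : Type*} [AddCommGroup E] [Module ℝ E]
    [Module 𝕜 E] [IsScalarTower ℝ 𝕜 E] [TopologicalSpace E] [IsTopologicalAddGroup E]
    [ContinuousSMul 𝕜 E] {G : Type*} [Group G] [TopologicalSpace G] [ChartedSpace E G]
    (h : IsLCLieGroup 𝕜 E G) : evol 𝕜 k E G 0 = 1 := by
  have h0 : IsProductIntegral 𝕜 (k + 1) (CkCurve.curve (0 : CkCurve 𝕜 k E)) (fun _ => (1 : G)) := by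
    rw [CkCurve.curve_zero]
    exact isProductIntegral_zero_one _
  rw [evol_eq h h0]

/-- Product integrals of smooth curves are smooth as soon as they exist, so that the evolution map on
smooth curves is the restriction of the evolution map on `C^k`-curves. -/
theorem HasSmoothEvolution.isMilnorRegular {𝕜 : Type*} [RCLike 𝕜] {k : ℕ∞} {E : Type*}
    [AddCommGroup E] [Module ℝ E] [Module 𝕜 E] [IsScalarTower ℝ 𝕜 E] [TopologicalSpace E]
    [IsTopologicalAddGroup E] [ContinuousSMul 𝕜 E] {G : Type*} [Group G] [TopologicalSpace G]
    [ChartedSpace E G] (h : IsLCLieGroup 𝕜 E G) (hG : HasSmoothEvolution 𝕜 k E G) :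
    IsMilnorRegular 𝕜 E G := by
  have hint : ∀ (γ : CkCurve 𝕜 (⊤ : ℕ∞) E) (η : unitInterval → G), IsProductIntegral 𝕜 (k + 1)
      (CkCurve.curve (CkCurve.restrict (le_top : k ≤ ⊤) γ)) η →
      IsProductIntegral 𝕜 (⊤ + 1) (CkCurve.curve γ) η := fun γ η hη =>
    ⟨hη.restrictScalars.isCrManifoldCurve_top h.restrictScalars (CkCurve.isCrCurveOn_curve γ),
      hη.2⟩
  have hevol : evol 𝕜 ⊤ E G = evol 𝕜 k E G ∘ CkCurve.restrict (le_top : k ≤ ⊤) := by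
    funext γ
    obtain ⟨η, hη⟩ := hG.1 (CkCurve.restrict le_top γ)
    rw [Function.comp_apply, evol_eq h hη, evol_eq h (hint γ η hη)]
  refine ⟨fun γ => ?_, hevol ▸ hG.2.comp_continuousLinearMap _⟩
  obtain ⟨η, hη⟩ := hG.1 (CkCurve.restrict le_top γ)
  exact ⟨η, hint γ η hη⟩

end

theorem mainTheorem5 {𝕜 : Type*} [RCLike 𝕜] (k : ℕ)
    {E : ℕ → Type*} [∀ n, AddCommGroup (E n)] [∀ n, Module ℝ (E n)] [∀ n, Module 𝕜 (E n)]
    [∀ n, IsScalarTower ℝ 𝕜 (E n)] [∀ n, TopologicalSpace (E n)]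
    [∀ n, IsTopologicalAddGroup (E n)] [∀ n, ContinuousSMul 𝕜 (E n)]
    {H : ℕ → Type*} [∀ n, Group (H n)] [∀ n, TopologicalSpace (H n)]
    [∀ n, ChartedSpace (E n) (H n)]
    (hLie : ∀ n, IsLCLieGroup 𝕜 (E n) (H n))
    (hreg : ∀ n, IsStronglyRegular 𝕜 (E n) (H n) k) :
    IsLCLieGroup 𝕜 (LCDirectSum E) (WeakProd H) ∧
    IsStronglyRegular 𝕜 (LCDirectSum E) (WeakProd H) k ∧
    IsMilnorRegular 𝕜 (LCDirectSum E) (WeakProd H) ∧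
    ∃ (Φ : CkCurve 𝕜 k (LCDirectSum E) ≃L[𝕜] LCDirectSum fun n => CkCurve 𝕜 k (E n))
      (h1 : ∀ n, evol 𝕜 k (E n) (H n) 0 = 1),
      (∀ γ n t, CkCurve.curve (Φ γ n) t = CkCurve.curve γ t n) ∧
      IsSmoothInto 𝕜 (LCDirectSum E)
        (FinProd.map (c := fun n => (1 : H n)) (fun n => evol 𝕜 k (E n) (H n))
          (Filter.Eventually.of_forall h1)) ∧
      evol 𝕜 k (LCDirectSum E) (WeakProd H) =
        FinProd.map (c := fun n => (1 : H n)) (fun n => evol 𝕜 k (E n) (H n))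
          (Filter.Eventually.of_forall h1) ∘ Φ := by
  have := fun n => (hLie n).model_t2
  have hL : IsLCLieGroup 𝕜 (LCDirectSum E) (WeakProd H) := WeakProd.isLCLieGroup hLie
  have h1 : ∀ n, evol 𝕜 k (E n) (H n) 0 = 1 := fun n => evol_zero (hLie n)
  have hint : ∀ γ : CkCurve 𝕜 k (LCDirectSum E), ∃ η : unitInterval → WeakProd H,
      IsProductIntegral 𝕜 (k + 1) (CkCurve.curve γ) η ∧
      ∀ n, η 1 n = evol 𝕜 k (E n) (H n) (CkCurve.component γ n) := by
    intro γ
    choose η hη using fun n => (hreg n).1 (CkCurve.component γ n)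
    have h0 : ∀ᶠ n in cofinite, ∀ t, η n t = 1 := by
      filter_upwards [CkCurve.eventually_component_eq_zero γ] with n hn t
      have h2 := hη n
      rw [hn, CkCurve.curve_zero] at h2
      exact congrFun (h2.restrictScalars.unique (hLie n).restrictScalars
        (isProductIntegral_zero_one (k + 1))) t
    have hγ : ∀ᶠ n in cofinite, ∀ t, CkCurve.curve γ t n = 0 := by
      filter_upwards [CkCurve.eventually_component_eq_zero γ] with n hn t
      rw [← CkCurve.curve_component, hn, CkCurve.curve_zero]
    exact ⟨fun t => ⟨fun n => η n t, h0.mono fun n hn => hn t⟩,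
      WeakProd.isProductIntegral hη hγ h0, fun n => (evol_eq (hLie n) (hη n)).symm⟩
  have hsmooth : IsSmoothInto 𝕜 (LCDirectSum E)
      (FinProd.map (c := fun n => (1 : H n)) (fun n => evol 𝕜 k (E n) (H n))
        (Filter.Eventually.of_forall h1)) := IsSmoothInto.weakProd (fun n => (hreg n).2) h1
  have hevol : evol 𝕜 k (LCDirectSum E) (WeakProd H) =
      FinProd.map (c := fun n => (1 : H n)) (fun n => evol 𝕜 k (E n) (H n))
        (Filter.Eventually.of_forall h1) ∘ CkCurve.directSumEquiv (𝕜 := 𝕜) (E := E) k := by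
    funext γ
    obtain ⟨η, hη, hη1⟩ := hint γ
    rw [evol_eq hL hη]
    exact FinProd.ext (funext hη1)
  have hstrong : IsStronglyRegular 𝕜 (LCDirectSum E) (WeakProd H) k := by
    refine ⟨fun γ => (hint γ).imp fun η hη => hη.1, ?_⟩
    rw [hevol]
    have h3 := hsmooth.comp_continuousLinearMap
      (CkCurve.directSumEquiv (𝕜 := 𝕜) (E := E) k).toContinuousLinearMap
    rwa [ContinuousLinearEquiv.coe_coe] at h3
  exact ⟨hL, hstrong, HasSmoothEvolution.isMilnorRegular hL hstrong,
    CkCurve.directSumEquiv k, h1, fun _ _ _ => rfl, hsmooth, hevol⟩
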